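/- Let $\varphi$ be a morphism on the ordered alphabet $\{0<1<\dots<q-1\}$ and let $u=u[0]u[1]\cdots$ be an infinite word with $\varphi(u)=u$. Infinite words are compared lexicographically, and $T^nu=u[n]u[n+1]\cdots$. Assume: - $\varphi$ is primitive: some positive power of the matrix $A$, whose entry $A_{ij}$ is the number of occurrences of $i$ in $\varphi(j)$, is entrywise positive; - $\varphi$ is monotone: for every infinite word $w$ and all $n,m>0$, $T^nw<T^mw$ if and only if $\varphi(T^nw)<\varphi(T^mw)$; - $u$ is aperiodic, i.e. not ultimately periodic; - $u$ is separable: say that a position $n$ has type $(a,p)$, $1\le p\le|\varphi(a)|$, if in the decomposition $u=\varphi(u[0])\varphi(u[1])\cdots$ it is the $p$-th position of a block $\varphi(u[m])$ with $u[m]=a$; then for positions $n,m$ of distinct types, the types of $n$ and $m$ determine whether $T^nu<T^mu$. For distinct types $\tau,\sigma$ write $\tau\prec\sigma$ if $T^nu<T^mu$ for positions $n,m$ of types $\tau,\sigma$. Then the uniform frequencies $\mu_0,\dots,\mu_{q-1}$ of the symbols in $u$ exist, and $A$ has a Perron–Frobenius eigenvalue $\theta$ (a positive eigenvalue with $\theta>|\lambda|$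 for every other complex eigenvalue $\lambda$ of $A$). Let $I_b$ be the interval with ends $\sum_{c<b}\mu_c$ and $\sum_{c\le b}\mu_c$, and let $J_{a,p}$ be the interval with ends $y_{a,p}=\sum_{(c,r)\prec(a,p)}\mu_c/\theta$ and $y_{a,p}+\mu_a/\theta$. All these intervals are taken of the form $(\cdot,\cdot]$ if some shift of $u$ is the lexicographically greatest among the shifts of $u$ that start with some given factor, and of the form $[\cdot,\cdot)$ otherwise. Let $\psi_{a,p}$ be the increasing affine map that sends $I_a$ onto $J_{a,p}$, and put $\psi(x)=\psi_{a,1}(x),\dots,\psi_{a,|\varphi(a)|}(x)$ for $x\in I_a$. Then: 1. $J_{a,p}\subseteq I_c$, where $c$ is the $p$-th symbol of $\varphi(a)$; 2. for $b=u[0]$, the map $\psi_{b,1}$ has exactly one fixed point $x$ in $I_b$; 3. there is exactly one infinite sequence $a=a[0],a[1],\dots$ of reals with $a[0]=x$ which is a fixed point of $\psi$, that is, $\psi(a[0])\psi(a[1])\cdots=a[0]a[1]\cdots$; 4. this sequence $a$ is the unique canonical representative of the infinite permutation $\alpha_u$. Here $\alpha_u$ is the class of all real sequences $s$ with pairwise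 distinct elements such that $s[i]<s[j]$ if and only if $0.T^iu<0.T^ju$ (numbers written in base $q$), and a sequence $s$ of pairwise distinct numbers of $[0,1]$ is canonical if for every $t\in[0,1]$ the proportion $\#\{0\le k<n: s[j+k]<t\}/n$ tends to $t$ as $n\to\infty$, uniformly in $j$. -/

import Mathlib

open Filter Topology

noncomputable section

namespace MorphicPerm

/-! ### Words, shifts, morphisms -/

/-- The shift `T^n s` of an infinite sequence `s`. -/
def shift {X : Type*} (n : ℕ) (s : ℕ → X) : ℕ → X := fun i => s (n + i)

/-- The (strict) lexicographic order on infinite words. -/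
def LexLt {q : ℕ} (u v : ℕ → Fin q) : Prop :=
  ∃ i, (∀ j < i, u j = v j) ∧ u i < v i

/-- `u` is not ultimately periodic. -/
def Aperiodic {X : Type*} (u : ℕ → X) : Prop :=
  ¬ ∃ p > 0, ∃ N, ∀ n ≥ N, u (n + p) = u n

/-- A morphism is given by the images `f x` of its symbols (or numbers) `x`. The position in
`f (s 0) f (s 1) f (s 2) ⋯` at which the block `f (s n)` starts. -/
def blockStart {X Y : Type*} (f : X → List Y) (s : ℕ → X) (n : ℕ) : ℕ :=
  ∑ i ∈ Finset.range n, (f (s i)).length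

/-- The concatenation `f (s 0) f (s 1) f (s 2) ⋯` is infinite and equal to the sequence `t`. -/
def IsImage {X Y : Type*} (f : X → List Y) (s : ℕ → X) (t : ℕ → Y) : Prop :=
  Tendsto (blockStart f s) atTop atTop ∧
    ∀ (n : ℕ) (p : Fin (f (s n)).length), t (blockStart f s n + p) = (f (s n)).get p

/-- `s` is a fixed point of the morphism `f`: `f (s 0) f (s 1) ⋯ = s 0 s 1 ⋯`. -/
def IsFixedPoint {X : Type*} (f : X → List X) (s : ℕ → X) : Prop := IsImage f s s

/-- The matrix of a morphism: the entry `(i, j)` is the number of occurrences of `i` in `φ j`. -/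
def morphismMatrix {q : ℕ} (R : Type*) [NatCast R] (φ : Fin q → List (Fin q)) :
    Matrix (Fin q) (Fin q) R :=
  Matrix.of fun i j => ((φ j).count i : R)

/-- Some power of the matrix of the morphism is entrywise positive. -/
def IsPrimitiveMorphism {q : ℕ} (φ : Fin q → List (Fin q)) : Prop :=
  (morphismMatrix ℝ φ).IsPrimitive

/-- `φ` is monotone on the infinite word `w`: for all `n, m > 0`,
`T^n w < T^m w` if and only if `φ (T^n w) < φ (T^m w)`. -/
def MonotoneOnWord {q : ℕ} (φ : Fin q → List (Fin q)) (w : ℕ → Fin q) : Prop :=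
  ∀ n > 0, ∀ m > 0, ∀ s t : ℕ → Fin q,
    IsImage φ (shift n w) s → IsImage φ (shift m w) t →
      (LexLt (shift n w) (shift m w) ↔ LexLt s t)

/-- `φ` is monotone on all infinite words. -/
def IsMonotoneMorphism {q : ℕ} (φ : Fin q → List (Fin q)) : Prop :=
  ∀ w : ℕ → Fin q, MonotoneOnWord φ w

/-! ### Types of positions and separability -/

/-- The types `(a, p)`; here the places in `φ a` are numbered from `0`, so that the pair
written `(a, 1)` with numbering from `1` is `⟨a, 0⟩`. -/
abbrev PosType {q : ℕ} (φ : Fin q → List (Fin q)) : Type :=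
  (a : Fin q) × Fin (φ a).length

/-- In the decomposition `u = φ (u 0) φ (u 1) ⋯`, the position `n` of `u` is
the place `p` of a block `φ a`, where `τ = (a, p)`. -/
def HasType {q : ℕ} (φ : Fin q → List (Fin q)) (u : ℕ → Fin q) (n : ℕ) (τ : PosType φ) : Prop :=
  ∃ m, u m = τ.1 ∧ n = blockStart φ u m + τ.2

/-- For positions `n`, `m` of distinct types, the types of `n` and `m`
determine the lexicographic relation between `T^n u` and `T^m u`. -/
def Separable {q : ℕ} (φ : Fin q → List (Fin q)) (u : ℕ → Fin q) : Prop :=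
  ∀ τ σ : PosType φ, τ ≠ σ → ∀ n m n' m' : ℕ,
    HasType φ u n τ → HasType φ u m σ → HasType φ u n' τ → HasType φ u m' σ →
      (LexLt (shift n u) (shift m u) ↔ LexLt (shift n' u) (shift m' u))

/-- The strict order `τ ≺ σ` on types of positions of a separable fixed point. -/
def TypeLt {q : ℕ} (φ : Fin q → List (Fin q)) (u : ℕ → Fin q) (τ σ : PosType φ) : Prop :=
  τ ≠ σ ∧ ∃ n m, HasType φ u n τ ∧ HasType φ u m σ ∧ LexLt (shift n u) (shift m u)

/-! ### Frequencies and the Perron–Frobenius eigenvalue -/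

open Classical in
/-- The proportion of those `k` with `j ≤ k < j + n` for which `P k` holds. -/
def windowFreq (P : ℕ → Prop) (n j : ℕ) : ℝ :=
  (((Finset.range n).filter fun k => P (j + k)).card : ℝ) / n

/-- The set of indices satisfying `P` has uniform frequency `r`: the proportion in windows of
length `n` tends to `r` as `n → ∞`, uniformly in the starting point of the window. -/
def HasUniformFreq (P : ℕ → Prop) (r : ℝ) : Prop :=
  TendstoUniformly (windowFreq P) (fun _ => r) atTop

/-- `θ` is the Perron–Frobenius eigenvalue of `φ`: a positive eigenvalue of the matrix of `φ`
with `θ > |z|` for every other complex eigenvalue `z`. -/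
def IsPerronFrobenius {q : ℕ} (φ : Fin q → List (Fin q)) (θ : ℝ) : Prop :=
  0 < θ ∧
  Module.End.HasEigenvalue (Matrix.toLin' (morphismMatrix ℂ φ)) (θ : ℂ) ∧
  ∀ z : ℂ, Module.End.HasEigenvalue (Matrix.toLin' (morphismMatrix ℂ φ)) z →
    z ≠ (θ : ℂ) → ‖z‖ < θ

/-! ### Infinite permutations and canonical representatives -/

/-- The equivalence of real sequences (with distinct elements) that defines permutations. -/
def OrderEquiv (s t : ℕ → ℝ) : Prop := ∀ i j, s i < s j ↔ t i < t j

/-- The infinite permutation `α_u`, as an equivalence class of real sequences with pairwise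
distinct elements: the class of the sequence of the numbers `0.T^n u` written in base `q`. -/
def wordPermutation {q : ℕ} (u : ℕ → Fin q) : Set (ℕ → ℝ) :=
  {s | Function.Injective s ∧ OrderEquiv s fun n => Real.ofDigits (shift n u)}

/-- Canonical sequences of numbers in `[0,1]`. -/
def IsCanonical (s : ℕ → ℝ) : Prop :=
  Function.Injective s ∧ (∀ i, s i ∈ Set.Icc (0 : ℝ) 1) ∧
    ∀ t ∈ Set.Icc (0 : ℝ) 1, HasUniformFreq (fun k => s k < t) t

/-- `s` is a canonical representative of the infinite permutation `α`. -/
def IsCanonicalRepresentative (α : Set (ℕ → ℝ)) (s : ℕ → ℝ) : Prop :=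
  s ∈ α ∧ IsCanonical s

/-! ### The interval morphism `ψ` -/

/-- For some factor `w` of `u`, some shift `T^k u` is the lexicographically maximal
one among the shifts of `u` that start with `w`. -/
def ContainsMax {q : ℕ} (u : ℕ → Fin q) : Prop :=
  ∃ k l : ℕ, ∀ m, (∀ i < l, u (m + i) = u (k + i)) → ¬ LexLt (shift k u) (shift m u)

open Classical in
/-- The interval with ends `x`, `y`: of the form `(x, y]` if `u` contains lexicographically
maximal elements, and of the form `[x, y)` otherwise. -/
def halfOpen {q : ℕ} (u : ℕ → Fin q) (x y : ℝ) : Set ℝ :=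
  if ContainsMax u then Set.Ioc x y else Set.Ico x y

/-- The lower end of `I_b`. -/
def loI {q : ℕ} (μ : Fin q → ℝ) (b : Fin q) : ℝ := ∑ c ∈ Finset.univ.filter (· < b), μ c

/-- The upper end of `I_b`. -/
def hiI {q : ℕ} (μ : Fin q → ℝ) (b : Fin q) : ℝ := loI μ b + μ b

/-- The interval `I_b`, of length `μ b`; these intervals are placed in the order of letters. -/
def intervalI {q : ℕ} (u : ℕ → Fin q) (μ : Fin q → ℝ) (b : Fin q) : Set ℝ :=
  halfOpen u (loI μ b) (hiI μ b)

open Classical in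
/-- The lower end of `J_τ`. -/
def loJ {q : ℕ} (φ : Fin q → List (Fin q)) (u : ℕ → Fin q) (μ : Fin q → ℝ) (θ : ℝ)
    (τ : PosType φ) : ℝ :=
  ∑ σ ∈ Finset.univ.filter (fun σ => TypeLt φ u σ τ), μ σ.1 / θ

/-- The upper end of `J_τ`. -/
def hiJ {q : ℕ} (φ : Fin q → List (Fin q)) (u : ℕ → Fin q) (μ : Fin q → ℝ) (θ : ℝ)
    (τ : PosType φ) : ℝ :=
  loJ φ u μ θ τ + μ τ.1 / θ

/-- The interval `J_τ`, of length `μ a / θ` for `τ = (a, p)`; these intervals are placed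
in the order of types. -/
def intervalJ {q : ℕ} (φ : Fin q → List (Fin q)) (u : ℕ → Fin q) (μ : Fin q → ℝ) (θ : ℝ)
    (τ : PosType φ) : Set ℝ :=
  halfOpen u (loJ φ u μ θ τ) (hiJ φ u μ θ τ)

/-- The affine map `ψ_{a,p}` which sends `I_a` to `J_{a,p}`. -/
def psiMap {q : ℕ} (φ : Fin q → List (Fin q)) (u : ℕ → Fin q) (μ : Fin q → ℝ) (θ : ℝ)
    (τ : PosType φ) (x : ℝ) : ℝ :=
  (hiJ φ u μ θ τ - loJ φ u μ θ τ) / (hiI μ τ.1 - loI μ τ.1) * (x - loI μ τ.1) + loJ φ u μ θ τ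

open Classical in
/-- The morphism `ψ`: for `x` in `I_a`, the list `ψ_{a,1}(x), …, ψ_{a,|φ(a)|}(x)`. (Outside of
the union of the disjoint intervals `I_a` it has the value `[]`.) -/
def psi {q : ℕ} (φ : Fin q → List (Fin q)) (u : ℕ → Fin q) (μ : Fin q → ℝ) (θ : ℝ)
    (x : ℝ) : List ℝ :=
  if h : ∃ a, x ∈ intervalI u μ a then
    List.ofFn fun p : Fin (φ h.choose).length => psiMap φ u μ θ ⟨h.choose, p⟩ x
  else []

end MorphicPerm

end

/-! Let a[k] be the uniform frequency of the positions x with T^x u < T^k u (`IsRankFunction`). A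
canonical representative s of the permutation must equal a: the set {x : s[x] < s[i]} is the set of
positions of shifts smaller than T^i u, and canonicity at t = s[i] says that its frequency is s[i].
It remains to show that these frequencies exist, that they satisfy the recursion given by ψ, and
that they represent the permutation canonically.

The recursion is `slope_smaller_block`. Let k be the place p of the block φ(u[m]). By separability
the positions of smaller shifts are all positions of smaller types, of total frequency y, together
with some positions of the same type as k. By monotonicity the latter come exactly from the blocks
m' with u[m'] = u[m] and T^m' u < T^m u. Passing from blocks to positions divides frequencies by θ,
so a slope r known at m up to an error ε gives the slope ψ_{u[m],p}(r) at k up to ε/θ. Starting from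
the trivial error 1 and iterating, the approximate slopes converge, because θ > 1
(`exists_isRankFunction`). Letter frequencies and θ come from Perron–Frobenius theory, proved by
contraction of a stochastic matrix.

Strict monotonicity of a (`IsRankFunction.lt_of_lexLt`) needs a shift between any two given ones. It
exists because a recurrent aperiodic word cannot have both locally greatest and locally least
shifts; this also explains the choice of half-open intervals. Contraction by the maps ψ makes the
values of a dense (`IsRankFunction.exists_near`), which yields canonicity. Finally, a fixed point of
ψ is determined by its first value, since every other position lies in a block of smaller index. -/

noncomputable section

namespace MorphicPerm

/-! ### Perron–Frobenius theory of primitive matrices -/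

section PerronFrobenius

variable {n : Type*} [Fintype n]

/-- The difference of the two means is the mean of f k - f l with weights p k * r l, and the
diagonal pair (k₀, k₀) contributes zero, so its weight can be dropped. -/
theorem norm_stochastic_sub_le {E : Type*} [NormedAddCommGroup E] [NormedSpace ℝ E]
    {p r : n → ℝ} (hp : ∀ k, 0 ≤ p k) (hr : ∀ k, 0 ≤ r k) (hp1 : ∑ k, p k = 1)
    (hr1 : ∑ k, r k = 1) {f : n → E} {R : ℝ} (hf : ∀ i j, ‖f i - f j‖ ≤ R) (k₀ : n) :
    ‖∑ k, p k • f k - ∑ k, r k • f k‖ ≤ (1 - p k₀ * r k₀) * R := by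
  classical
  have e : ∑ k, p k • f k - ∑ k, r k • f k = ∑ k, ∑ l, (p k * r l) • (f k - f l) := by
    have h1 : ∑ k, ∑ l, (p k * r l) • f k = ∑ k, p k • f k := by
      refine Finset.sum_congr rfl fun k _ => ?_
      rw [← Finset.sum_smul, ← Finset.mul_sum, hr1, mul_one]
    have h2 : ∑ k, ∑ l, (p k * r l) • f l = ∑ k, r k • f k := by
      rw [Finset.sum_comm]
      refine Finset.sum_congr rfl fun k _ => ?_
      rw [← Finset.sum_smul, ← Finset.sum_mul, hp1, one_mul]
    simp only [smul_sub, Finset.sum_sub_distrib, h1, h2]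
  have hb : ∀ k l, ‖(p k * r l) • (f k - f l)‖ ≤
      p k * r l * R - (if k = k₀ then if l = k₀ then p k * r l * R else 0 else 0) := by
    intro k l
    rw [norm_smul, Real.norm_of_nonneg (mul_nonneg (hp k) (hr l))]
    have := mul_le_mul_of_nonneg_left (hf k l) (mul_nonneg (hp k) (hr l))
    split_ifs with h h' <;> simp_all
  calc _ ≤ ∑ k, ∑ l, ‖(p k * r l) • (f k - f l)‖ := by
        rw [e]
        exact (norm_sum_le _ _).trans (Finset.sum_le_sum fun k _ => norm_sum_le _ _)
    _ ≤ ∑ k, ∑ l, (p k * r l * R -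
          (if k = k₀ then if l = k₀ then p k * r l * R else 0 else 0)) :=
        Finset.sum_le_sum fun k _ => Finset.sum_le_sum fun l _ => hb k l
    _ = (∑ k, p k) * (∑ l, r l) * R - p k₀ * r k₀ * R := by
        simp only [Finset.sum_sub_distrib]
        congr 1
        · rw [Finset.sum_mul_sum, Finset.sum_mul]
          exact Finset.sum_congr rfl fun k _ => by rw [Finset.sum_mul]
        · rw [Finset.sum_eq_single k₀ (by intro b _ hb; simp [hb]) (by simp)]
          simp
    _ = _ := by rw [hp1, hr1]; ring

theorem mulVec_nonneg {A : Matrix n n ℝ} (hA : ∀ i j, 0 ≤ A i j) {x : n → ℝ}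
    (hx : ∀ i, 0 ≤ x i) (i : n) : 0 ≤ (A.mulVec x) i :=
  Finset.sum_nonneg fun j _ => mul_nonneg (hA i j) (hx j)

theorem mulVec_pos {A : Matrix n n ℝ} (hA : ∀ i j, 0 < A i j) {x : n → ℝ}
    (hx : ∀ i, 0 ≤ x i) (hx0 : x ≠ 0) (i : n) : 0 < (A.mulVec x) i := by
  obtain ⟨j, hj⟩ := Function.ne_iff.mp hx0
  exact Finset.sum_pos' (fun j _ => mul_nonneg (hA i j).le (hx j))
    ⟨j, Finset.mem_univ _, mul_pos (hA i j) (lt_of_le_of_ne (hx j) (Ne.symm hj))⟩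

variable [DecidableEq n]

theorem pow_mulVec_of_eigen {A : Matrix n n ℝ} {x : n → ℝ} {θ : ℝ} (h : A.mulVec x = θ • x)
    (k : ℕ) : (A ^ k).mulVec x = θ ^ k • x := by
  induction k with
  | zero => simp
  | succ k ih =>
    rw [pow_succ, ← Matrix.mulVec_mulVec, h, Matrix.mulVec_smul, ih, smul_smul, pow_succ, mul_comm]

/-- The existence of a positive eigenvector of a primitive matrix. -/
theorem exists_pos_eigenvector [Nonempty n] {A : Matrix n n ℝ} (hA : A.IsPrimitive) :
    ∃ (μ : n → ℝ) (θ : ℝ), 0 < θ ∧ (∀ i, 0 < μ i) ∧ ∑ i, μ i = 1 ∧ A.mulVec μ = θ • μ := by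
  obtain ⟨h0, k, hk, hpos⟩ := hA
  set M : ℝ := ∑ i, ∑ j, A i j
  -- Collatz–Wielandt: θ is the greatest number with θ x ≤ A x for some x in the simplex. The sum M
  -- of all entries bounds such numbers, which makes the set compact.
  let K : Set ((n → ℝ) × ℝ) := (stdSimplex ℝ n ×ˢ Set.Icc 0 M) ∩
    {p | ∀ i, p.2 * p.1 i ≤ (A.mulVec p.1) i}
  have hK : IsCompact K := by
    refine ((isCompact_stdSimplex (𝕜 := ℝ) (ι := n)).prod isCompact_Icc).inter_right ?_
    simp only [Set.ofPred_forall]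
    refine isClosed_iInter fun i => isClosed_le (by fun_prop) ?_
    simp only [Matrix.mulVec, dotProduct]
    fun_prop
  have hle : ∀ x ∈ stdSimplex ℝ n, ∀ r : ℝ, (∀ i, r * x i ≤ (A.mulVec x) i) → r ≤ M := by
    intro x hx r hr
    calc r = ∑ i, r * x i := by rw [← Finset.mul_sum, hx.2, mul_one]
      _ ≤ ∑ i, (A.mulVec x) i := Finset.sum_le_sum fun i _ => hr i
      _ ≤ M := by
        refine Finset.sum_le_sum fun i _ => Finset.sum_le_sum fun j _ => ?_
        refine mul_le_of_le_one_right (h0 i j) ?_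
        rw [← hx.2]
        exact Finset.single_le_sum (fun j _ => hx.1 j) (Finset.mem_univ j)
  have hne : K.Nonempty := by
    obtain ⟨i⟩ := ‹Nonempty n›
    refine ⟨(Pi.single i 1, 0), ⟨⟨single_mem_stdSimplex ℝ i, le_rfl,
      Finset.sum_nonneg fun i _ => Finset.sum_nonneg fun j _ => h0 i j⟩, fun j => ?_⟩⟩
    simp only [zero_mul]
    exact mulVec_nonneg h0 (single_mem_stdSimplex ℝ i).1 j
  obtain ⟨⟨x, θ⟩, ⟨⟨hx, hθ⟩, hxθ⟩, hmax⟩ := hK.exists_isMaxOn hne continuous_snd.continuousOn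
  simp only [Set.mem_ofPred_eq] at hx hθ hxθ
  have hx0 : x ≠ 0 := by
    rintro rfl
    simpa using hx.2
  have hyp := mulVec_pos hpos hx.1 hx0
  set y := (A ^ k).mulVec x
  -- Otherwise the positive matrix A ^ k turns θ x ≤ A x into a strict inequality in every
  -- coordinate for y, so the normalized y admits a number r > θ.
  have heig : A.mulVec x = θ • x := by
    by_contra hcon
    have hz : A.mulVec x - θ • x ≠ 0 := sub_ne_zero.mpr hcon
    have hzpos := mulVec_pos hpos (x := A.mulVec x - θ • x)
      (fun i => by simpa using hxθ i) hz
    have hzy : (A ^ k).mulVec (A.mulVec x - θ • x) = A.mulVec y - θ • y := by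
      rw [Matrix.mulVec_sub, Matrix.mulVec_smul, Matrix.mulVec_mulVec, ← pow_succ, pow_succ',
        ← Matrix.mulVec_mulVec]
    rw [hzy] at hzpos
    obtain ⟨i₀, -, hi₀⟩ := Finset.exists_min_image Finset.univ
      (fun i => (A.mulVec y) i / y i) Finset.univ_nonempty
    set r := (A.mulVec y) i₀ / y i₀
    have hr : θ < r := by
      rw [lt_div_iff₀ (hyp i₀)]
      simpa using hzpos i₀
    have hry : ∀ i, r * y i ≤ (A.mulVec y) i := fun i => by
      rw [← le_div_iff₀ (hyp i)]; exact hi₀ i (Finset.mem_univ i)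
    have hs : 0 < ∑ i, y i := Finset.sum_pos (fun i _ => hyp i) Finset.univ_nonempty
    set y' := (∑ i, y i)⁻¹ • y with hy'
    have hy's : y' ∈ stdSimplex ℝ n := by
      refine ⟨fun i => ?_, ?_⟩
      · simp only [hy', Pi.smul_apply, smul_eq_mul]
        exact mul_nonneg (inv_nonneg.mpr hs.le) (hyp i).le
      · simp only [hy', Pi.smul_apply, smul_eq_mul, ← Finset.mul_sum]
        exact inv_mul_cancel₀ hs.ne'
    have hry' : ∀ i, r * y' i ≤ (A.mulVec y') i := fun i => by
      simp only [hy', Matrix.mulVec_smul, Pi.smul_apply, smul_eq_mul]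
      rw [mul_left_comm]
      exact mul_le_mul_of_nonneg_left (hry i) (inv_nonneg.mpr hs.le)
    have : r ≤ θ := hmax (a := (y', r)) ⟨⟨hy's, (hθ.1.trans hr.le), hle y' hy's r hry'⟩, hry'⟩
    exact absurd hr this.not_gt
  have hyk : y = θ ^ k • x := pow_mulVec_of_eigen heig k
  have hpr : ∀ i, 0 < θ ^ k * x i := fun i => by simpa [hyk] using hyp i
  refine ⟨x, θ, lt_of_le_of_ne hθ.1 ?_, fun i => ?_, hx.2, heig⟩
  · rintro rfl
    simpa [zero_pow hk.ne'] using hpr (Classical.arbitrary n)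
  · exact pos_of_mul_pos_right (hpr i) (pow_nonneg hθ.1 k)

/-- The stochastic matrix conjugate to `θ⁻¹ A`, for an eigenvector `μ` of `A`. -/
def stochasticOf (A : Matrix n n ℝ) (μ : n → ℝ) (θ : ℝ) : Matrix n n ℝ :=
  Matrix.of fun i j => A i j * μ j / (θ * μ i)

variable {A : Matrix n n ℝ} {μ : n → ℝ} {θ : ℝ}

/-- The matrix is θ⁻¹ A conjugated by the diagonal matrix of μ, so the inner factors cancel in
powers. -/
theorem stochasticOf_pow (hθ : 0 < θ) (hμ : ∀ i, 0 < μ i) (k : ℕ) (i j : n) :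
    (stochasticOf A μ θ ^ k) i j = (A ^ k) i j * μ j / (θ ^ k * μ i) := by
  induction k generalizing i j with
  | zero =>
    rcases eq_or_ne i j with rfl | h
    · simp [div_self (hμ i).ne']
    · simp [h]
  | succ k ih =>
    rw [pow_succ, pow_succ, Matrix.mul_apply, Matrix.mul_apply, Finset.sum_mul, Finset.sum_div]
    refine Finset.sum_congr rfl fun l _ => ?_
    rw [ih, stochasticOf, Matrix.of_apply]
    have := (hμ l).ne'
    have := (hμ i).ne'
    field_simp
    ring

theorem stochasticOf_pow_sum (hθ : 0 < θ) (hμ : ∀ i, 0 < μ i) (h : A.mulVec μ = θ • μ) (k : ℕ)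
    (i : n) : ∑ j, (stochasticOf A μ θ ^ k) i j = 1 := by
  have := congrFun (pow_mulVec_of_eigen h k) i
  simp only [Matrix.mulVec, dotProduct, Pi.smul_apply, smul_eq_mul] at this
  simp only [stochasticOf_pow hθ hμ, ← Finset.sum_div, this]
  exact div_self (mul_pos (pow_pos hθ k) (hμ i)).ne'

/-- Every complex eigenvalue of a primitive matrix other than the one with a positive
eigenvector has smaller absolute value. -/
theorem norm_lt_of_eigenvalue (hA : A.IsPrimitive) (hθ : 0 < θ) (hμ : ∀ i, 0 < μ i)
    (h : A.mulVec μ = θ • μ) {z : ℂ} {v : n → ℂ} (hv : v ≠ 0)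
    (hz : (A.map (algebraMap ℝ ℂ)).mulVec v = z • v) (hzθ : z ≠ θ) : ‖z‖ < θ := by
  obtain ⟨h0, k, hk, hpos⟩ := hA
  obtain ⟨i₁, hi₁⟩ := Function.ne_iff.mp hv
  have : Nonempty n := ⟨i₁⟩
  -- In these coordinates f is an eigenvector of the stochastic matrix P for (z / θ) ^ k. Positivity
  -- of P strictly shrinks the greatest difference of coordinates of f, unless that difference is
  -- zero.
  set f : n → ℂ := fun i => v i / μ i with hf
  have hvf : ∀ i, v i = μ i * f i := fun i => by
    rw [hf]; field_simp [Complex.ofReal_ne_zero.mpr (hμ i).ne']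
  have hpow : ∀ k i, ∑ j, ((A ^ k) i j : ℂ) * v j = z ^ k * v i := by
    intro k
    induction k with
    | zero => intro i; simp [Matrix.one_apply, apply_ite Complex.ofReal]
    | succ k ih =>
      intro i
      simp only [pow_succ, Matrix.mul_apply, Complex.ofReal_sum, Complex.ofReal_mul,
        Finset.sum_mul]
      rw [Finset.sum_comm]
      have hzl : ∀ l, ∑ j, (A l j : ℂ) * v j = z * v l := fun l => by
        simpa [Matrix.mulVec, dotProduct] using congrFun hz l
      simp only [mul_assoc, ← Finset.mul_sum, hzl]
      simp only [mul_left_comm _ z, ← Finset.mul_sum, ih]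
  set P := stochasticOf A μ θ ^ k with hP
  have hPf : ∀ i, ∑ j, P i j • f j = (z ^ k / θ ^ k) * f i := by
    intro i
    have hμi := Complex.ofReal_ne_zero.mpr (hμ i).ne'
    have hθ' := Complex.ofReal_ne_zero.mpr hθ.ne'
    calc ∑ j, P i j • f j = ∑ j, ((A ^ k) i j : ℂ) * v j / (θ ^ k * μ i) := by
          refine Finset.sum_congr rfl fun j _ => ?_
          rw [hP, stochasticOf_pow hθ hμ, hvf j, Complex.real_smul]
          push_cast
          ring
      _ = _ := by
          rw [← Finset.sum_div, hpow, hvf i]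
          field_simp
  have hP0 : ∀ i j, 0 < P i j := fun i j => by
    rw [hP, stochasticOf_pow hθ hμ]
    exact div_pos (mul_pos (hpos i j) (hμ j)) (mul_pos (pow_pos hθ k) (hμ i))
  have hP1 : ∀ i, ∑ j, P i j = 1 := stochasticOf_pow_sum hθ hμ h k
  obtain ⟨⟨a, b⟩, -, hab⟩ := Finset.exists_max_image (Finset.univ : Finset (n × n))
    (fun p => ‖f p.1 - f p.2‖) Finset.univ_nonempty
  have hab' : ∀ i j, ‖f i - f j‖ ≤ ‖f a - f b‖ := fun i j => hab (i, j) (Finset.mem_univ _)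
  have key := norm_stochastic_sub_le (fun j => (hP0 a j).le) (fun j => (hP0 b j).le) (hP1 a)
    (hP1 b) hab' a
  rw [hPf, hPf, ← mul_sub, norm_mul, norm_div, norm_pow, norm_pow, Complex.norm_real,
    Real.norm_of_nonneg hθ.le, ← div_pow] at key
  rcases (norm_nonneg (f a - f b)).eq_or_lt with h0' | hlt
  · exfalso
    -- A constant f means that v is proportional to μ, hence z = θ.
    have hconst : ∀ i, f i = f i₁ := fun i => by
      have := hab' i i₁
      rw [← h0'] at this
      exact sub_eq_zero.mp (norm_le_zero_iff.mp this)
    have hzl : ∑ j, (A i₁ j : ℂ) * v j = z * v i₁ := by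
      simpa [Matrix.mulVec, dotProduct] using congrFun hz i₁
    have hθl : ∑ j, (A i₁ j : ℂ) * μ j = θ * μ i₁ := by
      have := congrFun h i₁
      simp only [Matrix.mulVec, dotProduct, Pi.smul_apply, smul_eq_mul] at this
      exact_mod_cast this
    have : z * v i₁ = θ * v i₁ := by
      rw [← hzl, hvf i₁, ← mul_assoc, ← hθl, Finset.sum_mul]
      refine Finset.sum_congr rfl fun j _ => ?_
      rw [hvf j, hconst j, mul_assoc]
    exact hzθ (mul_right_cancel₀ hi₁ this)
  · have h1 : (‖z‖ / θ) ^ k < 1 := by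
      have := le_of_mul_le_mul_right key hlt
      have := mul_pos (hP0 a a) (hP0 b a)
      linarith
    rwa [pow_lt_one_iff_of_nonneg (by positivity) hk.ne', div_lt_one hθ] at h1

/-- Large powers of a primitive matrix send nonnegative vectors close to the direction of
the positive eigenvector. -/
theorem exists_pow_near_eigenvector (hA : A.IsPrimitive) (hθ : 0 < θ) (hμ : ∀ i, 0 < μ i)
    (hμ1 : ∑ i, μ i = 1) (h : A.mulVec μ = θ • μ) {η : ℝ} (hη : 0 < η) :
    ∃ L : ℕ, ∀ x : n → ℝ, (∀ i, 0 ≤ x i) → ∀ i,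
      |((A ^ L).mulVec x) i - μ i * ∑ l, ((A ^ L).mulVec x) l| ≤
        η * ∑ l, ((A ^ L).mulVec x) l := by
  obtain ⟨h0, k, hk, hpos⟩ := hA
  rcases isEmpty_or_nonempty n with hn | hn
  · exact ⟨0, fun x _ i => hn.elim i⟩
  set P := stochasticOf A μ θ with hPdef
  have hP0 : ∀ i j, 0 < (P ^ k) i j := fun i j => by
    rw [hPdef, stochasticOf_pow hθ hμ]
    exact div_pos (mul_pos (hpos i j) (hμ j)) (mul_pos (pow_pos hθ k) (hμ i))
  have hP1 : ∀ k i, ∑ j, (P ^ k) i j = 1 := fun k => stochasticOf_pow_sum hθ hμ h k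
  obtain ⟨⟨i₁, j₁⟩, -, hmin⟩ := Finset.exists_min_image (Finset.univ : Finset (n × n))
    (fun p => (P ^ k) p.1 p.2) Finset.univ_nonempty
  set δ := (P ^ k) i₁ j₁ with hδdef
  have hδ : 0 < δ := hP0 i₁ j₁
  have hδle : ∀ i j, δ ≤ (P ^ k) i j := fun i j => hmin (i, j) (Finset.mem_univ _)
  have hc1 : 1 - δ ^ 2 < 1 := by have := pow_pos hδ 2; linarith
  have hcontr : ∀ m (f : n → ℝ) (R : ℝ), (∀ i j, |f i - f j| ≤ R) → ∀ i j,
      |((P ^ (k * m)).mulVec f) i - ((P ^ (k * m)).mulVec f) j| ≤ (1 - δ ^ 2) ^ m * R := by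
    intro m
    induction m with
    | zero => intro f R hf i j; simpa using hf i j
    | succ m ih =>
      intro f R hf i j
      have hR : 0 ≤ R := (abs_nonneg _).trans (hf i j)
      have := ih ((P ^ k).mulVec f) ((1 - δ ^ 2) * R) (fun i j => ?_) i j
      · rw [Matrix.mulVec_mulVec, ← pow_add] at this
        rw [mul_add, mul_one]
        exact this.trans (by rw [pow_succ _ m, mul_assoc])
      · have key := norm_stochastic_sub_le (fun l => (hP0 i l).le) (fun l => (hP0 j l).le)
          (hP1 k i) (hP1 k j) (f := f) (R := R) hf i
        refine key.trans (mul_le_mul_of_nonneg_right ?_ hR)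
        have := mul_le_mul (hδle i i) (hδle j i) hδ.le (hP0 i i).le
        nlinarith
  -- With k * m + k steps the oscillation of g is at most (1 - δ²)^m max f, while the positive
  -- factor P ^ k keeps every coordinate of g above δ max f. The extra δ in the bound for m makes
  -- the oscillation small relative to g itself.
  obtain ⟨m, hm⟩ := exists_pow_lt_of_lt_one (mul_pos hη hδ) hc1
  refine ⟨k * m + k, fun x hx i => ?_⟩
  set f : n → ℝ := fun i => x i / μ i with hf
  have hf0 : ∀ i, 0 ≤ f i := fun i => div_nonneg (hx i) (hμ i).le
  set g := (P ^ (k * m + k)).mulVec f with hg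
  have hAg : ∀ i, ((A ^ (k * m + k)).mulVec x) i = θ ^ (k * m + k) * μ i * g i := by
    intro i
    simp only [hg, Matrix.mulVec, dotProduct, Finset.mul_sum]
    refine Finset.sum_congr rfl fun j _ => ?_
    have := (hμ i).ne'
    have := (hμ j).ne'
    rw [hPdef, stochasticOf_pow hθ hμ, hf]
    field_simp
  obtain ⟨j₂, -, hj₂⟩ := Finset.exists_max_image (Finset.univ : Finset n) f Finset.univ_nonempty
  have hosc : ∀ i j, |g i - g j| ≤ η * (δ * f j₂) := by
    intro i j
    have h1 := hcontr m ((P ^ k).mulVec f) (f j₂) (fun i j => ?_) i j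
    · rw [Matrix.mulVec_mulVec, ← pow_add] at h1
      refine h1.trans ?_
      rw [← mul_assoc]
      exact mul_le_mul_of_nonneg_right hm.le (hf0 j₂)
    · have := norm_stochastic_sub_le (fun l => (hP0 i l).le) (fun l => (hP0 j l).le)
          (hP1 k i) (hP1 k j) (f := f) (R := f j₂) (fun a b => abs_sub_le_iff.mpr ⟨?_, ?_⟩) i
      · refine this.trans (mul_le_of_le_one_left (hf0 j₂) ?_)
        have := mul_pos (hP0 i i) (hP0 j i)
        linarith
      · linarith [hj₂ a (Finset.mem_univ _), hf0 b]
      · linarith [hj₂ b (Finset.mem_univ _), hf0 a]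
  have hlow : ∀ i, δ * f j₂ ≤ g i := by
    intro i
    have h2 : ∀ i, δ * f j₂ ≤ ((P ^ k).mulVec f) i := fun i =>
      (mul_le_mul_of_nonneg_right (hδle i j₂) (hf0 j₂)).trans
        (Finset.single_le_sum (f := fun j => (P ^ k) i j * f j)
          (fun j _ => mul_nonneg (hP0 i j).le (hf0 j)) (Finset.mem_univ j₂))
    have hPn : ∀ i j, 0 ≤ (P ^ (k * m)) i j := fun i j => by
      rw [hPdef, stochasticOf_pow hθ hμ]
      refine div_nonneg (mul_nonneg ?_ (hμ j).le) (mul_pos (pow_pos hθ _) (hμ i)).le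
      exact Matrix.pow_apply_nonneg h0 _ i j
    rw [hg, pow_add, ← Matrix.mulVec_mulVec]
    calc δ * f j₂ = ∑ j, (P ^ (k * m)) i j * (δ * f j₂) := by
          rw [← Finset.sum_mul, hP1, one_mul]
      _ ≤ _ := Finset.sum_le_sum fun j _ => mul_le_mul_of_nonneg_left (h2 j) (hPn i j)
  have hμ1' : μ i ≤ 1 := by
    rw [← hμ1]; exact Finset.single_le_sum (fun l _ => (hμ l).le) (Finset.mem_univ i)
  have hT : 0 < θ ^ (k * m + k) := pow_pos hθ _
  simp only [hAg]
  set T := θ ^ (k * m + k)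
  -- Since the μ l sum to 1, the deviation from the direction μ is a weighted mean of the
  -- differences of g.
  have e1 : T * μ i * g i - μ i * ∑ l, T * μ l * g l =
      T * μ i * ∑ l, μ l * (g i - g l) := by
    simp only [mul_sub, Finset.sum_sub_distrib, ← Finset.sum_mul, hμ1, one_mul, Finset.mul_sum]
    congr 1
    exact Finset.sum_congr rfl fun l _ => by ring
  rw [e1, abs_mul, abs_of_pos (mul_pos hT (hμ i))]
  calc T * μ i * |∑ l, μ l * (g i - g l)| ≤ T * 1 * ∑ l, μ l * (η * g l) := by
        refine mul_le_mul (mul_le_mul_of_nonneg_left hμ1' hT.le) ?_ (abs_nonneg _) (by positivity)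
        refine (Finset.abs_sum_le_sum_abs _ _).trans (Finset.sum_le_sum fun l _ => ?_)
        rw [abs_mul, abs_of_pos (hμ l)]
        exact mul_le_mul_of_nonneg_left ((hosc i l).trans
          (mul_le_mul_of_nonneg_left (hlow l) hη.le)) (hμ l).le
    _ = _ := by
        rw [mul_one, Finset.mul_sum, Finset.mul_sum]
        exact Finset.sum_congr rfl fun l _ => by ring

end PerronFrobenius

/-! ### Uniform slopes of real functions on `ℕ` -/

/-- The function `f` has uniform slope `r` up to an error `ε`. -/
def HasSlope (f : ℕ → ℝ) (r ε : ℝ) : Prop :=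
  ∀ ε' > ε, ∃ C, ∀ i j : ℕ, i ≤ j →
    |f j - f i - r * ((j : ℝ) - i)| ≤ ε' * ((j : ℝ) - i) + C

theorem cast_sub_nonneg {i j : ℕ} (h : i ≤ j) : (0 : ℝ) ≤ (j : ℝ) - i :=
  sub_nonneg.mpr (Nat.cast_le.mpr h)

theorem HasSlope.mono {f : ℕ → ℝ} {r ε δ : ℝ} (h : HasSlope f r ε) (hε : ε ≤ δ) :
    HasSlope f r δ := fun ε' hε' => h ε' (hε.trans_lt hε')

theorem HasSlope.add {f g : ℕ → ℝ} {r s ε δ : ℝ} (hf : HasSlope f r ε) (hg : HasSlope g s δ) :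
    HasSlope (fun k => f k + g k) (r + s) (ε + δ) := by
  intro ε' hε'
  obtain ⟨C, hC⟩ := hf (ε + (ε' - (ε + δ)) / 2) (by linarith)
  obtain ⟨D, hD⟩ := hg (δ + (ε' - (ε + δ)) / 2) (by linarith)
  refine ⟨C + D, fun i j hij => ?_⟩
  have h1 := hC i j hij
  have h2 := hD i j hij
  rw [abs_le] at *
  constructor <;> linarith

theorem HasSlope.const_mul {f : ℕ → ℝ} {r : ℝ} (hf : HasSlope f r 0) (c : ℝ) :
    HasSlope (fun k => c * f k) (c * r) 0 := by
  intro ε' hε'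
  have hc : 0 < |c| + 1 := by positivity
  obtain ⟨C, hC⟩ := hf (ε' / (|c| + 1)) (div_pos hε' hc)
  refine ⟨|c| * C, fun i j hij => ?_⟩
  have h1 := mul_le_mul_of_nonneg_left (hC i j hij) (abs_nonneg c)
  rw [← abs_mul] at h1
  have h2 : |c| * (ε' / (|c| + 1)) ≤ ε' := by
    rw [← mul_div_assoc, div_le_iff₀ hc]
    nlinarith [abs_nonneg c]
  have h3 := mul_le_mul_of_nonneg_right h2 (cast_sub_nonneg hij)
  calc _ = |c * (f j - f i - r * ((j : ℝ) - i))| := by congr 1; ring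
    _ ≤ _ := by linarith

theorem HasSlope.sub {f g : ℕ → ℝ} {r s ε : ℝ} (hf : HasSlope f r ε) (hg : HasSlope g s 0) :
    HasSlope (fun k => f k - g k) (r - s) ε := by
  have := hf.add (hg.const_mul (-1))
  simpa [sub_eq_add_neg] using this

theorem hasSlope_zero : HasSlope (fun _ => 0) 0 0 := fun ε' hε' =>
  ⟨0, fun i j hij => by simpa using mul_nonneg hε'.le (cast_sub_nonneg hij)⟩

theorem HasSlope.sum {ι : Type*} (t : Finset ι) {f : ι → ℕ → ℝ} {r : ι → ℝ}
    (h : ∀ x ∈ t, HasSlope (f x) (r x) 0) :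
    HasSlope (fun k => ∑ x ∈ t, f x k) (∑ x ∈ t, r x) 0 := by
  classical
  induction t using Finset.induction_on with
  | empty => simpa using hasSlope_zero
  | insert a t ha ih =>
    simp only [Finset.sum_insert ha]
    simpa using (h a (Finset.mem_insert_self a t)).add
      (ih fun x hx => h x (Finset.mem_insert_of_mem hx))

theorem HasSlope.of_bounded_sub {f g : ℕ → ℝ} {r ε B : ℝ} (hf : HasSlope f r ε)
    (hB : ∀ k, |g k - f k| ≤ B) : HasSlope g r ε := by
  intro ε' hε'
  obtain ⟨C, hC⟩ := hf ε' hε'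
  refine ⟨C + 2 * B, fun i j hij => ?_⟩
  have h1 := hC i j hij
  have h2 := hB i
  have h3 := hB j
  rw [abs_le] at *
  constructor <;> linarith

theorem nonpos_of_mul_nat_le {x C : ℝ} (h : ∀ n : ℕ, x * n ≤ C) : x ≤ 0 := by
  by_contra! hx
  obtain ⟨n, hn⟩ := exists_nat_gt (C / x)
  rw [div_lt_iff₀ hx, mul_comm] at hn
  exact absurd (h n) hn.not_ge

/-- Additive constants are negligible against n. The summand c * n serves to convert a positive
lower density into a strict inequality of slopes; c = 0 gives plain comparison. -/
theorem HasSlope.le_of_increments {f g : ℕ → ℝ} {r s ε δ c C : ℝ} (hf : HasSlope f r ε)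
    (hg : HasSlope g s δ)
    (h : ∀ n : ℕ, f n - f 0 + c * n ≤ g n - g 0 + C) : r + c ≤ s + ε + δ := by
  refine le_of_forall_pos_le_add fun t ht => ?_
  obtain ⟨C₁, h₁⟩ := hf (ε + t / 2) (by linarith)
  obtain ⟨C₂, h₂⟩ := hg (δ + t / 2) (by linarith)
  have := nonpos_of_mul_nat_le (x := r + c - (s + ε + δ + t)) (C := C + C₁ + C₂) fun n => by
    have a := h n
    have a1 := (abs_le.mp (h₁ 0 n n.zero_le)).1
    have a2 := (abs_le.mp (h₂ 0 n n.zero_le)).2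
    simp only [Nat.cast_zero, sub_zero] at a1 a2
    linarith
  linarith

theorem HasSlope.abs_sub_le {f : ℕ → ℝ} {r s ε δ : ℝ} (hf : HasSlope f r ε)
    (hg : HasSlope f s δ) : |r - s| ≤ ε + δ := by
  have h1 := hf.le_of_increments hg (c := 0) (C := 0) fun n => by simp
  have h2 := hg.le_of_increments hf (c := 0) (C := 0) fun n => by simp
  rw [abs_le]
  constructor <;> linarith

theorem HasSlope.unique {f : ℕ → ℝ} {r s : ℝ} (hf : HasSlope f r 0) (hg : HasSlope f s 0) :
    r = s := by
  have := hf.abs_sub_le hg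
  rw [add_zero] at this
  exact sub_eq_zero.mp (abs_nonpos_iff.mp this)

theorem HasSlope.of_close {f : ℕ → ℝ} {r s ε δ : ℝ} (hf : HasSlope f r ε) (h : |r - s| ≤ δ) :
    HasSlope f s (ε + δ) := by
  intro ε' hε'
  obtain ⟨C, hC⟩ := hf (ε' - δ) (by linarith)
  refine ⟨C, fun i j hij => ?_⟩
  have h1 := hC i j hij
  have h2 := mul_le_mul_of_nonneg_right h (cast_sub_nonneg hij)
  calc |f j - f i - s * ((j : ℝ) - i)|
      = |(f j - f i - r * ((j : ℝ) - i)) + (r - s) * ((j : ℝ) - i)| := by congr 1; ring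
    _ ≤ |f j - f i - r * ((j : ℝ) - i)| + |r - s| * ((j : ℝ) - i) := by
        refine (abs_add_le _ _).trans ?_
        rw [abs_mul (r - s), abs_of_nonneg (cast_sub_nonneg hij)]
    _ ≤ _ := by linarith

theorem hasSlope_zero_of_forall_pos {f : ℕ → ℝ} {r : ℝ} (h : ∀ ε > 0, HasSlope f r ε) :
    HasSlope f r 0 := fun ε' hε' => h (ε' / 2) (by linarith) ε' (by linarith)

/-- Two approximate slopes of one function differ by at most the sum of their errors, so they form a
Cauchy sequence. -/
theorem exists_hasSlope_of_tendsto_zero {f : ℕ → ℝ} {ε : ℕ → ℝ} (hε : Tendsto ε atTop (𝓝 0))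
    (h : ∀ n, ∃ r, HasSlope f r (ε n)) : ∃ r, HasSlope f r 0 := by
  choose r hr using h
  have hc : CauchySeq r := by
    rw [Metric.cauchySeq_iff]
    intro t ht
    obtain ⟨N, hN⟩ := Filter.eventually_atTop.mp (hε.eventually_lt_const (half_pos ht))
    refine ⟨N, fun m hm n hn => ?_⟩
    have := (hr m).abs_sub_le (hr n)
    rw [Real.dist_eq]
    linarith [hN m hm, hN n hn]
  obtain ⟨s, hs⟩ := cauchySeq_tendsto_of_complete hc
  refine ⟨s, hasSlope_zero_of_forall_pos fun t ht => ?_⟩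
  obtain ⟨n, h1, h2⟩ := ((hε.eventually_lt_const (half_pos ht)).and
    (hs.eventually (Metric.ball_mem_nhds s (half_pos ht)))).exists
  rw [Real.dist_eq] at h2
  exact ((hr n).of_close h2.le).mono (by linarith)

theorem HasSlope.comp {f : ℕ → ℝ} {g : ℕ → ℕ} {r s ε : ℝ} (hf : HasSlope f r ε)
    (hg : HasSlope (fun k => (g k : ℝ)) s 0) (hmono : Monotone g) (hs : 0 ≤ s) (hε : 0 ≤ ε) :
    HasSlope (fun k => f (g k)) (r * s) (ε * s) := by
  intro ε' hε'
  set D := ε + s + 1 + |r| + 1 with hD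
  have hD0 : 0 < D := by positivity
  -- Chosen so that (ε + t)(s + t) + |r| t ≤ ε'; the bound t ≤ 1 replaces t² by t.
  set t := min 1 ((ε' - ε * s) / D) with ht
  have ht0 : 0 < t := lt_min one_pos (div_pos (by linarith) hD0)
  have ht1 : t ≤ 1 := min_le_left _ _
  have ht2 : t * D ≤ ε' - ε * s := by
    rw [← le_div_iff₀ hD0]; exact min_le_right _ _
  obtain ⟨C₁, h₁⟩ := hf (ε + t) (by linarith)
  obtain ⟨C₂, h₂⟩ := hg t ht0
  refine ⟨C₁ + (ε + t) * C₂ + |r| * C₂, fun i j hij => ?_⟩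
  have a1 := h₁ _ _ (hmono hij)
  have a2 := h₂ i j hij
  have a0 := cast_sub_nonneg hij
  have a3 := mul_le_mul_of_nonneg_left a2 (abs_nonneg r)
  rw [← abs_mul] at a3
  have a4 := mul_le_mul_of_nonneg_left ((le_abs_self _).trans a2) (by linarith : 0 ≤ ε + t)
  have a5 : (ε + t) * (s + t) + |r| * t ≤ ε' := by
    have : t * t ≤ t * 1 := mul_le_mul_of_nonneg_left ht1 ht0.le
    nlinarith
  have a6 := mul_le_mul_of_nonneg_right a5 a0
  calc |f (g j) - f (g i) - r * s * ((j : ℝ) - i)|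
      = |(f (g j) - f (g i) - r * ((g j : ℝ) - g i)) +
          r * ((g j : ℝ) - g i - s * ((j : ℝ) - i))| := by congr 1; ring
    _ ≤ _ := abs_add_le _ _
    _ ≤ ε' * ((j : ℝ) - i) + (C₁ + (ε + t) * C₂ + |r| * C₂) := by linarith

/-- The slope of an approximate inverse of a strictly increasing function. -/
theorem HasSlope.approx_inverse {g h : ℕ → ℕ} {s : ℝ} {M : ℕ}
    (hg : HasSlope (fun k => (g k : ℝ)) s 0) (hs : 0 < s) (hgm : StrictMono g) (hh : Monotone h)
    (h1 : ∀ k, g (h k) ≤ k) (h2 : ∀ k, k ≤ g (h k) + M) :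
    HasSlope (fun k => (h k : ℝ)) s⁻¹ 0 := by
  intro ε' hε'
  obtain ⟨C, hC⟩ := hg (ε' * s) (mul_pos hε' hs)
  refine ⟨s⁻¹ * (ε' * s * M + C + M), fun i j hij => ?_⟩
  have a1 := hC _ _ (hh hij)
  have b1 : (g (h i) : ℝ) ≤ i := Nat.cast_le.mpr (h1 i)
  have b2 : (g (h j) : ℝ) ≤ j := Nat.cast_le.mpr (h1 j)
  have b3 : (i : ℝ) ≤ g (h i) + M := by exact_mod_cast h2 i
  have b4 : (j : ℝ) ≤ g (h j) + M := by exact_mod_cast h2 j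
  -- As g grows by at least 1 per step, this bounds the increment of h by j - i + M, so the error
  -- measured along h becomes an error measured along j - i.
  have b5 : (h j : ℝ) - h i ≤ g (h j) - g (h i) := by
    obtain ⟨d, hd⟩ := Nat.exists_eq_add_of_le (hh hij)
    have := hgm.add_le_nat d (h i)
    have hd' : (h j : ℝ) = h i + d := by exact_mod_cast hd
    have : (d : ℝ) + g (h i) ≤ g (h j) := by
      rw [hd, add_comm (h i) d]; exact_mod_cast this
    linarith
  have b6 := mul_le_mul_of_nonneg_left (b5.trans (by linarith : _ ≤ (j : ℝ) - i + M))
    (mul_pos hε' hs).le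
  have key : |s * ((h j : ℝ) - h i) - ((j : ℝ) - i)| ≤
      ε' * s * ((j : ℝ) - i) + (ε' * s * M + C + M) := by
    rw [abs_le] at *
    constructor <;> linarith
  calc |(h j : ℝ) - h i - s⁻¹ * ((j : ℝ) - i)|
      = |s⁻¹ * (s * ((h j : ℝ) - h i) - ((j : ℝ) - i))| := by
        congr 1; field_simp
    _ = s⁻¹ * |s * ((h j : ℝ) - h i) - ((j : ℝ) - i)| := by
        rw [abs_mul, abs_of_pos (inv_pos.mpr hs)]
    _ ≤ s⁻¹ * (ε' * s * ((j : ℝ) - i) + (ε' * s * M + C + M)) :=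
        mul_le_mul_of_nonneg_left key (inv_pos.mpr hs).le
    _ = _ := by field_simp

/-! ### Counting functions and uniform frequencies -/

open Classical in
/-- The number of those `x < k` with `S x`. -/
def countBelow (S : ℕ → Prop) (k : ℕ) : ℝ := ∑ x ∈ Finset.range k, if S x then 1 else 0

theorem countBelow_zero (S : ℕ → Prop) : countBelow S 0 = 0 := by simp [countBelow]

theorem countBelow_mono_sub {S R : ℕ → Prop} (h : ∀ x, S x → R x) {i j : ℕ} (hij : i ≤ j) :
    countBelow S j - countBelow S i ≤ countBelow R j - countBelow R i := by
  classical
  simp only [countBelow, ← Finset.sum_Ico_eq_sub _ hij]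
  refine Finset.sum_le_sum fun x _ => ?_
  split_ifs with h1 h2 h2
  · exact le_rfl
  · exact absurd (h x h1) h2
  · exact zero_le_one
  · exact le_rfl

theorem countBelow_true (k : ℕ) : countBelow (fun _ => True) k = k := by simp [countBelow]

theorem countBelow_false (k : ℕ) : countBelow (fun _ => False) k = 0 := by simp [countBelow]

theorem countBelow_sub_nonneg (S : ℕ → Prop) {i j : ℕ} (hij : i ≤ j) :
    0 ≤ countBelow S j - countBelow S i := by
  simpa [countBelow_false] using
    countBelow_mono_sub (S := fun _ => False) (R := S) (fun _ h => h.elim) hij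

theorem countBelow_sub_le (S : ℕ → Prop) {i j : ℕ} (hij : i ≤ j) :
    countBelow S j - countBelow S i ≤ (j : ℝ) - i := by
  simpa [countBelow_true] using
    countBelow_mono_sub (S := S) (R := fun _ => True) (fun _ _ => trivial) hij

theorem countBelow_or {S R : ℕ → Prop} (h : ∀ x, S x → ¬ R x) (k : ℕ) :
    countBelow (fun x => S x ∨ R x) k = countBelow S k + countBelow R k := by
  classical
  simp only [countBelow, ← Finset.sum_add_distrib]
  refine Finset.sum_congr rfl fun x _ => ?_
  by_cases h1 : S x
  · simp [h1, h x h1]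
  · simp [h1]

theorem countBelow_exists {ι : Type*} (t : Finset ι) {S : ι → ℕ → Prop}
    (h : ∀ a ∈ t, ∀ b ∈ t, ∀ x, S a x → S b x → a = b) (k : ℕ) :
    countBelow (fun x => ∃ a ∈ t, S a x) k = ∑ a ∈ t, countBelow (S a) k := by
  classical
  simp only [countBelow]
  rw [Finset.sum_comm]
  refine Finset.sum_congr rfl fun x _ => ?_
  by_cases hx : ∃ a ∈ t, S a x
  · obtain ⟨a, ha, hax⟩ := hx
    rw [if_pos ⟨a, ha, hax⟩, Finset.sum_eq_single_of_mem a ha, if_pos hax]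
    exact fun b hb hba => if_neg fun hbx => hba (h b hb a ha x hbx hax)
  · rw [if_neg hx, Finset.sum_eq_zero]
    exact fun a ha => if_neg fun hax => hx ⟨a, ha, hax⟩

theorem windowFreq_eq (S : ℕ → Prop) (n j : ℕ) :
    windowFreq S n j = (countBelow S (j + n) - countBelow S j) / n := by
  classical
  rw [windowFreq, countBelow, countBelow, Finset.sum_range_add_sub_sum_range]
  simp

/-- The additive constant of a slope absorbs the short windows; conversely, it is less than (ε / 2)
n once n is large. -/
theorem hasUniformFreq_iff {S : ℕ → Prop} {r : ℝ} :
    HasUniformFreq S r ↔ HasSlope (countBelow S) r 0 := by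
  rw [HasUniformFreq, Metric.tendstoUniformly_iff]
  constructor
  · intro h ε hε
    obtain ⟨N, hN⟩ := Filter.eventually_atTop.mp (h ε hε)
    refine ⟨(1 + |r|) * (N + 1), fun i j hij => ?_⟩
    obtain ⟨n, rfl⟩ := Nat.exists_eq_add_of_le hij
    have hn0 : (0 : ℝ) ≤ n := Nat.cast_nonneg n
    have e : ((i + n : ℕ) : ℝ) - i = n := by push_cast; ring
    rw [e]
    rcases le_or_gt (N + 1) n with hn | hn
    · have hn' : (0 : ℝ) < n := by exact_mod_cast (by omega : 0 < n)
      have := hN n (by omega) i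
      rw [windowFreq_eq, Real.dist_eq, abs_sub_comm, div_sub' hn'.ne', abs_div,
        abs_of_pos hn', div_lt_iff₀ hn', mul_comm (n : ℝ) r] at this
      have : 0 ≤ (1 + |r|) * ((N : ℝ) + 1) := by positivity
      linarith
    · have h1 := countBelow_sub_nonneg S hij
      have h2 := countBelow_sub_le S hij
      rw [e] at h2
      have hnN : (n : ℝ) ≤ N + 1 := by exact_mod_cast hn.le
      have h3 : (1 + |r|) * (n : ℝ) ≤ (1 + |r|) * ((N : ℝ) + 1) := by gcongr
      have h4 : 0 ≤ ε * n := by positivity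
      calc _ ≤ |countBelow S (i + n) - countBelow S i| + |r * n| := abs_sub _ _
        _ ≤ n + |r| * n := by
          rw [abs_mul, abs_of_nonneg hn0, abs_of_nonneg h1]; linarith
        _ ≤ _ := by linarith
  · intro h ε hε
    obtain ⟨C, hC⟩ := h (ε / 2) (half_pos hε)
    obtain ⟨N, hN⟩ := exists_nat_gt (C / (ε / 2))
    filter_upwards [Filter.eventually_ge_atTop (N + 1)] with n hn i
    have hn' : (0 : ℝ) < n := by exact_mod_cast (by omega : 0 < n)
    have := hC i (i + n) (by omega)
    have e : ((i + n : ℕ) : ℝ) - i = n := by push_cast; ring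
    rw [e] at this
    rw [windowFreq_eq, Real.dist_eq, abs_sub_comm, div_sub' hn'.ne', abs_div,
        abs_of_pos hn', div_lt_iff₀ hn', mul_comm (n : ℝ) r]
    rw [div_lt_iff₀ (half_pos hε)] at hN
    have hnN : (N : ℝ) ≤ n := by exact_mod_cast (by omega : N ≤ n)
    have := mul_le_mul_of_nonneg_right hnN (half_pos hε).le
    linarith

/-! ### Blocks of a fixed point of a primitive morphism -/

variable {q : ℕ} {φ : Fin q → List (Fin q)} {u : ℕ → Fin q}

theorem morphismMatrix_apply (a b : Fin q) : morphismMatrix ℝ φ a b = ((φ b).count a : ℝ) := rfl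

theorem sum_count_eq_length (l : List (Fin q)) : ∑ b, (l.count b : ℝ) = l.length := by
  have := Multiset.sum_count_eq_card (s := Finset.univ) (m := (l : Multiset (Fin q)))
    (fun a _ => Finset.mem_univ a)
  simp only [Multiset.coe_count, Multiset.coe_card] at this
  exact_mod_cast this

/-- An empty image would give a zero column of the matrix, and of all its positive powers. -/
theorem IsPrimitiveMorphism.length_pos (h : IsPrimitiveMorphism φ) (a : Fin q) :
    0 < (φ a).length := by
  obtain ⟨-, k, hk, hpos⟩ := h
  rw [List.length_pos_iff]
  intro ha
  obtain ⟨k, rfl⟩ := Nat.exists_eq_succ_of_ne_zero hk.ne'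
  have := hpos a a
  rw [Nat.succ_eq_add_one, pow_succ, Matrix.mul_apply, Finset.sum_eq_zero] at this
  · exact lt_irrefl _ this
  · intro b _
    rw [morphismMatrix_apply, ha]
    simp

theorem blockStart_zero (φ : Fin q → List (Fin q)) (u : ℕ → Fin q) : blockStart φ u 0 = 0 := by
  simp [blockStart]

theorem blockStart_succ (φ : Fin q → List (Fin q)) (u : ℕ → Fin q) (m : ℕ) :
    blockStart φ u (m + 1) = blockStart φ u m + (φ (u m)).length := by
  simp [blockStart, Finset.sum_range_succ]

theorem IsPrimitiveMorphism.blockStart_strictMono (h : IsPrimitiveMorphism φ) (u : ℕ → Fin q) :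
    StrictMono (blockStart φ u) :=
  strictMono_nat_of_lt_succ fun m => by
    rw [blockStart_succ]; exact Nat.lt_add_of_pos_right (h.length_pos _)

theorem IsFixedPoint.apply_add (hfix : IsFixedPoint φ u) (m : ℕ) (p : Fin (φ (u m)).length) :
    u (blockStart φ u m + p) = (φ (u m)).get p := hfix.2 m p

/-- The index of the block that contains the position `k`. -/
def blockIndex (φ : Fin q → List (Fin q)) (u : ℕ → Fin q) (k : ℕ) : ℕ :=
  Nat.findGreatest (fun m => blockStart φ u m ≤ k) k

theorem blockStart_blockIndex_le (φ : Fin q → List (Fin q)) (u : ℕ → Fin q) (k : ℕ) :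
    blockStart φ u (blockIndex φ u k) ≤ k :=
  Nat.findGreatest_spec (P := fun m => blockStart φ u m ≤ k) (Nat.zero_le k)
    (by simp [blockStart_zero])

theorem IsPrimitiveMorphism.lt_blockStart_blockIndex_succ (h : IsPrimitiveMorphism φ)
    (u : ℕ → Fin q) (k : ℕ) : k < blockStart φ u (blockIndex φ u k + 1) := by
  rcases le_or_gt (blockIndex φ u k + 1) k with hk | hk
  · exact not_le.mp (Nat.findGreatest_is_greatest (P := fun m => blockStart φ u m ≤ k)
      (Nat.lt_succ_self _) hk)
  · exact hk.trans_le ((h.blockStart_strictMono u).le_apply)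

theorem IsPrimitiveMorphism.lt_blockStart_blockIndex_add (h : IsPrimitiveMorphism φ)
    (u : ℕ → Fin q) (k : ℕ) :
    k < blockStart φ u (blockIndex φ u k) + (φ (u (blockIndex φ u k))).length := by
  rw [← blockStart_succ]; exact h.lt_blockStart_blockIndex_succ u k

theorem IsPrimitiveMorphism.exists_position (h : IsPrimitiveMorphism φ) (u : ℕ → Fin q) (k : ℕ) :
    ∃ m, ∃ p : Fin (φ (u m)).length, k = blockStart φ u m + p := by
  have h1 := blockStart_blockIndex_le φ u k
  have h2 := h.lt_blockStart_blockIndex_add u k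
  exact ⟨blockIndex φ u k, ⟨k - blockStart φ u (blockIndex φ u k), by omega⟩, by simp; omega⟩

theorem IsPrimitiveMorphism.position_unique (h : IsPrimitiveMorphism φ) {m m' p p' : ℕ}
    (hp : p < (φ (u m)).length) (hp' : p' < (φ (u m')).length)
    (e : blockStart φ u m + p = blockStart φ u m' + p') : m = m' ∧ p = p' := by
  have key : ∀ {m m' p p' : ℕ}, p < (φ (u m)).length →
      blockStart φ u m + p = blockStart φ u m' + p' → ¬ m < m' := by
    intro m m' p p' hp e hlt
    have := (h.blockStart_strictMono u).monotone (Nat.succ_le_of_lt hlt)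
    rw [Nat.succ_eq_add_one, blockStart_succ] at this
    omega
  have hm : m = m' := le_antisymm (not_lt.mp (key hp' e.symm)) (not_lt.mp (key hp e))
  subst hm
  exact ⟨rfl, by omega⟩

theorem IsPrimitiveMorphism.blockIndex_mono (h : IsPrimitiveMorphism φ) (u : ℕ → Fin q) :
    Monotone (blockIndex φ u) := by
  intro i j hij
  have h1 := blockStart_blockIndex_le φ u i
  have h2 := h.lt_blockStart_blockIndex_succ u j
  exact Nat.lt_succ_iff.mp
    ((h.blockStart_strictMono u).lt_iff_lt.mp (h1.trans_lt (hij.trans_lt h2)))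

/-- A bound for the lengths of blocks. -/
def lengthBound (φ : Fin q → List (Fin q)) : ℕ := ∑ a, (φ a).length

theorem length_le_lengthBound (a : Fin q) : (φ a).length ≤ lengthBound φ :=
  Finset.single_le_sum (f := fun a => (φ a).length) (fun _ _ => Nat.zero_le _) (Finset.mem_univ a)

theorem IsPrimitiveMorphism.le_blockStart_blockIndex_add (h : IsPrimitiveMorphism φ)
    (u : ℕ → Fin q) (k : ℕ) :
    k ≤ blockStart φ u (blockIndex φ u k) + lengthBound φ :=
  (h.lt_blockStart_blockIndex_add u k).le.trans
    (Nat.add_le_add_left (length_le_lengthBound _) _)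

theorem countBelow_blockStart_succ (R : ℕ → Prop) [DecidablePred R] (m : ℕ) :
    countBelow R (blockStart φ u (m + 1)) = countBelow R (blockStart φ u m) +
      ∑ x ∈ Finset.range (φ (u m)).length, if R (blockStart φ u m + x) then 1 else 0 := by
  rw [countBelow, blockStart_succ, Finset.sum_range_add, countBelow]
  congr!

theorem IsPrimitiveMorphism.abs_countBelow_sub_le (h : IsPrimitiveMorphism φ) (u : ℕ → Fin q)
    (R : ℕ → Prop) (k : ℕ) :
    |countBelow R k - countBelow R (blockStart φ u (blockIndex φ u k))| ≤ lengthBound φ := by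
  have h1 := blockStart_blockIndex_le φ u k
  have h2 := h.le_blockStart_blockIndex_add u k
  rw [abs_of_nonneg (countBelow_sub_nonneg R h1)]
  refine (countBelow_sub_le R h1).trans ?_
  rw [sub_le_iff_le_add']
  exact_mod_cast h2

/-! ### Frequencies of letters -/

theorem sum_range_ite_eq_count (l : List (Fin q)) (t : ℕ → Fin q)
    (h : ∀ p : Fin l.length, t p = l.get p) (b : Fin q) :
    ∑ x ∈ Finset.range l.length, (if t x = b then (1 : ℝ) else 0) = l.count b := by
  induction l generalizing t with
  | nil => simp
  | cons a l ih =>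
    rw [List.length_cons, Finset.sum_range_succ', ih (fun x => t (x + 1)), List.count_cons]
    · have : t 0 = a := h ⟨0, by simp⟩
      simp [this]
    · intro p
      exact h p.succ

/-- The numbers of occurrences of letters in the prefix of length `k`. -/
def letterCount (u : ℕ → Fin q) (k : ℕ) (b : Fin q) : ℝ := countBelow (fun n => u n = b) k

/-- The prefix ending before block m is the image under φ of the prefix of length m. -/
theorem IsFixedPoint.letterCount_blockStart (hfix : IsFixedPoint φ u) (m : ℕ) :
    letterCount u (blockStart φ u m) = (morphismMatrix ℝ φ).mulVec (letterCount u m) := by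
  classical
  ext b
  induction m with
  | zero => simp [blockStart_zero, letterCount, countBelow_zero, Matrix.mulVec, dotProduct]
  | succ m ih =>
    simp only [letterCount] at ih ⊢
    rw [countBelow_blockStart_succ, ih, sum_range_ite_eq_count (φ (u m))
      (fun x => u (blockStart φ u m + x)) (hfix.apply_add m)]
    simp only [Matrix.mulVec, dotProduct, letterCount, countBelow, Finset.sum_range_succ, mul_add,
      Finset.sum_add_distrib, mul_ite, mul_one, mul_zero, Finset.sum_ite_eq, Finset.mem_univ,
      if_true, morphismMatrix_apply]

theorem sum_letterCount (u : ℕ → Fin q) (k : ℕ) : ∑ b, letterCount u k b = k := by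
  simp only [letterCount]
  rw [← countBelow_exists Finset.univ (fun a _ b _ x h1 h2 => h1.symm.trans h2)]
  simpa using countBelow_true k

/-- Up to the two boundary blocks a window is the image of a window, and this can be repeated L
times. At each level the old error is multiplied by the matrix and two boundary terms are added. -/
theorem exists_window_near_pow (h : IsPrimitiveMorphism φ) (hfix : IsFixedPoint φ u) (L : ℕ) :
    ∃ C : ℝ, ∀ i j : ℕ, i ≤ j → ∃ x : Fin q → ℝ, (∀ b, 0 ≤ x b) ∧ ∀ b,
      |letterCount u j b - letterCount u i b - ((morphismMatrix ℝ φ ^ L).mulVec x) b| ≤ C := by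
  set A := morphismMatrix ℝ φ
  induction L with
  | zero =>
    refine ⟨0, fun i j hij => ⟨fun b => letterCount u j b - letterCount u i b,
      fun b => countBelow_sub_nonneg _ hij, fun b => by simp⟩⟩
  | succ L ih =>
    obtain ⟨C, hC⟩ := ih
    refine ⟨2 * lengthBound φ + ∑ b, ∑ c, A b c * |C|, fun i j hij => ?_⟩
    obtain ⟨x, hx, hxC⟩ := hC _ _ (h.blockIndex_mono u hij)
    refine ⟨x, hx, fun b => ?_⟩
    have h1 := h.abs_countBelow_sub_le u (fun n => u n = b) i
    have h2 := h.abs_countBelow_sub_le u (fun n => u n = b) j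
    set w : Fin q → ℝ := fun b => letterCount u (blockIndex φ u j) b -
      letterCount u (blockIndex φ u i) b - ((A ^ L).mulVec x) b with hw
    have h3 : letterCount u (blockStart φ u (blockIndex φ u j)) b -
        letterCount u (blockStart φ u (blockIndex φ u i)) b - ((A ^ (L + 1)).mulVec x) b =
        (A.mulVec w) b := by
      have : w = letterCount u (blockIndex φ u j) - letterCount u (blockIndex φ u i) -
        (A ^ L).mulVec x := rfl
      rw [this, Matrix.mulVec_sub, Matrix.mulVec_sub, hfix.letterCount_blockStart,
        hfix.letterCount_blockStart, Matrix.mulVec_mulVec, ← pow_succ']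
      rfl
    have h4 : |(A.mulVec w) b| ≤ ∑ b, ∑ c, A b c * |C| := by
      calc |(A.mulVec w) b| ≤ ∑ c, |A b c * w c| :=
          Finset.abs_sum_le_sum_abs (fun c => A b c * w c) Finset.univ
        _ ≤ ∑ c, A b c * |C| := Finset.sum_le_sum fun c _ => by
            rw [abs_mul, abs_of_nonneg (h.1 b c)]
            exact mul_le_mul_of_nonneg_left ((hxC c).trans (le_abs_self C)) (h.1 b c)
        _ ≤ _ := Finset.single_le_sum (f := fun b => ∑ c, A b c * |C|)
            (fun b _ => Finset.sum_nonneg fun c _ => mul_nonneg (h.1 b c) (abs_nonneg C))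
            (Finset.mem_univ b)
    rw [← h3] at h4
    simp only [letterCount] at h4 ⊢
    rw [abs_le] at *
    constructor <;> linarith

theorem hasSlope_letterCount (h : IsPrimitiveMorphism φ) (hfix : IsFixedPoint φ u)
    {μ : Fin q → ℝ} {θ : ℝ} (hθ : 0 < θ) (hμ : ∀ i, 0 < μ i) (hμ1 : ∑ i, μ i = 1)
    (heig : (morphismMatrix ℝ φ).mulVec μ = θ • μ) (b : Fin q) :
    HasSlope (countBelow fun n => u n = b) (μ b) 0 := by
  intro η hη
  obtain ⟨L, hL⟩ := exists_pow_near_eigenvector h hθ hμ hμ1 heig hη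
  obtain ⟨C, hC⟩ := exists_window_near_pow h hfix L
  refine ⟨C + μ b * (q * C) + η * (q * C), fun i j hij => ?_⟩
  obtain ⟨x, hx, hxC⟩ := hC i j hij
  have h1 := hL x hx b
  have h2 := hxC b
  set y := ((morphismMatrix ℝ φ) ^ L).mulVec x
  have h3 : |((j : ℝ) - i) - ∑ l, y l| ≤ q * C := by
    rw [← sum_letterCount u j, ← sum_letterCount u i, ← Finset.sum_sub_distrib,
      ← Finset.sum_sub_distrib]
    refine (Finset.abs_sum_le_sum_abs _ _).trans ?_
    refine (Finset.sum_le_sum fun l _ => hxC l).trans ?_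
    simp
  have h4 := mul_le_mul_of_nonneg_left h3 (hμ b).le
  rw [← abs_of_pos (hμ b), ← abs_mul, abs_of_pos (hμ b)] at h4
  have h5 : η * ∑ l, y l ≤ η * (((j : ℝ) - i) + q * C) :=
    mul_le_mul_of_nonneg_left (by linarith [(abs_le.mp h3).1]) hη.le
  simp only [letterCount] at h2
  rw [abs_le] at h1 h2 h4 ⊢
  constructor <;> linarith

/-! ### Frequencies of images of sets of blocks -/

/-- Block lengths are the column sums of the matrix, so θ is the mean block length. -/
theorem sum_length_mul_eq {μ : Fin q → ℝ} {θ : ℝ} (hμ1 : ∑ i, μ i = 1)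
    (heig : (morphismMatrix ℝ φ).mulVec μ = θ • μ) : ∑ a, ((φ a).length : ℝ) * μ a = θ := by
  calc ∑ a, ((φ a).length : ℝ) * μ a = ∑ a, ∑ b, morphismMatrix ℝ φ b a * μ a := by
        refine Finset.sum_congr rfl fun a _ => ?_
        rw [← Finset.sum_mul]
        simp only [morphismMatrix_apply, sum_count_eq_length]
    _ = ∑ b, ((morphismMatrix ℝ φ).mulVec μ) b := by rw [Finset.sum_comm]; rfl
    _ = θ := by simp [heig, ← Finset.mul_sum, hμ1]

theorem hasSlope_blockStart {μ : Fin q → ℝ} {θ : ℝ} (hμ1 : ∑ i, μ i = 1)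
    (heig : (morphismMatrix ℝ φ).mulVec μ = θ • μ)
    (hs : ∀ b, HasSlope (countBelow fun n => u n = b) (μ b) 0) :
    HasSlope (fun m => (blockStart φ u m : ℝ)) θ 0 := by
  have := HasSlope.sum Finset.univ fun a _ => (hs a).const_mul ((φ a).length : ℝ)
  rw [sum_length_mul_eq hμ1 heig] at this
  convert this using 2 with m
  induction m with
  | zero => simp [blockStart_zero, countBelow_zero]
  | succ m ih =>
    rw [blockStart_succ, Nat.cast_add, ih]
    simp [countBelow, Finset.sum_range_succ, mul_add, Finset.sum_add_distrib]

/-- The positions at the place `p` of the blocks with indices in `S`. -/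
def blockImage (φ : Fin q → List (Fin q)) (u : ℕ → Fin q) (S : ℕ → Prop) (p : ℕ) : ℕ → Prop :=
  fun k => ∃ m, S m ∧ k = blockStart φ u m + p

theorem countBelow_blockImage (h : IsPrimitiveMorphism φ) {S : ℕ → Prop} {p : ℕ}
    (hS : ∀ m, S m → p < (φ (u m)).length) (m : ℕ) :
    countBelow (blockImage φ u S p) (blockStart φ u m) = countBelow S m := by
  classical
  induction m with
  | zero => simp [blockStart_zero, countBelow_zero]
  | succ m ih =>
    rw [countBelow_blockStart_succ, ih]
    simp only [countBelow, Finset.sum_range_succ]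
    congr 1
    have key : ∀ x ∈ Finset.range (φ (u m)).length,
        (blockImage φ u S p (blockStart φ u m + x) ↔ S m ∧ x = p) := by
      intro x hx
      constructor
      · rintro ⟨m', hm', e⟩
        obtain ⟨rfl, rfl⟩ := h.position_unique (Finset.mem_range.mp hx) (hS m' hm') e
        exact ⟨hm', rfl⟩
      · rintro ⟨hm, rfl⟩
        exact ⟨m, hm, rfl⟩
    rw [Finset.sum_congr rfl fun x hx => if_congr (key x hx) rfl rfl]
    by_cases hm : S m
    · simp [hm, hS m hm]
    · simp [hm]

/-- Each block of S carries exactly one marked position, and the block index has slope 1 / θ. The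
error is divided by θ as well; this contraction drives the whole construction. -/
theorem HasSlope.blockImage (h : IsPrimitiveMorphism φ) {θ : ℝ} (hθ : 0 < θ) {S : ℕ → Prop}
    {r ε : ℝ} (hS : HasSlope (countBelow S) r ε)
    (hbs : HasSlope (fun m => (blockStart φ u m : ℝ)) θ 0) {p : ℕ}
    (hp : ∀ m, S m → p < (φ (u m)).length) (hε : 0 ≤ ε) :
    HasSlope (countBelow (blockImage φ u S p)) (r / θ) (ε / θ) := by
  have hidx : HasSlope (fun k => (blockIndex φ u k : ℝ)) θ⁻¹ 0 :=
    hbs.approx_inverse hθ (h.blockStart_strictMono u) (h.blockIndex_mono u)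
      (blockStart_blockIndex_le φ u) (h.le_blockStart_blockIndex_add u)
  refine (hS.comp hidx (h.blockIndex_mono u) (inv_pos.mpr hθ).le hε).of_bounded_sub
    (B := lengthBound φ) fun k => ?_
  rw [← countBelow_blockImage h hp]
  exact h.abs_countBelow_sub_le u _ k

/-! ### The lexicographic order on shifts -/

theorem lexLt_irrefl (s : ℕ → Fin q) : ¬ LexLt s s := fun ⟨_, _, h⟩ => lt_irrefl _ h

theorem LexLt.trans {s t w : ℕ → Fin q} (h1 : LexLt s t) (h2 : LexLt t w) : LexLt s w := by
  obtain ⟨i, hi, hi'⟩ := h1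
  obtain ⟨j, hj, hj'⟩ := h2
  rcases lt_trichotomy i j with h | h | h
  · exact ⟨i, fun k hk => (hi k hk).trans (hj k (hk.trans h)), (hj i h) ▸ hi'⟩
  · subst h
    exact ⟨i, fun k hk => (hi k hk).trans (hj k hk), hi'.trans hj'⟩
  · exact ⟨j, fun k hk => (hi k (hk.trans h)).trans (hj k hk), (hi j h).symm ▸ hj'⟩

theorem LexLt.asymm {s t : ℕ → Fin q} (h : LexLt s t) : ¬ LexLt t s :=
  fun h' => lexLt_irrefl s (h.trans h')

theorem lexLt_or_lexLt_of_ne {s t : ℕ → Fin q} (h : s ≠ t) : LexLt s t ∨ LexLt t s := by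
  classical
  have hex : ∃ i, s i ≠ t i := Function.ne_iff.mp h
  have hmin : ∀ j < Nat.find hex, s j = t j := fun j hj => not_not.mp (Nat.find_min hex hj)
  rcases lt_or_gt_of_ne (Nat.find_spec hex) with h | h
  · exact Or.inl ⟨_, hmin, h⟩
  · exact Or.inr ⟨_, fun j hj => (hmin j hj).symm, h⟩

theorem shift_shift {X : Type*} (m n : ℕ) (s : ℕ → X) :
    shift m (shift n s) = shift (n + m) s := by
  ext i; simp [shift, add_assoc]

theorem lexLt_iff_of_prefix_eq {s t : ℕ → Fin q} {p : ℕ} (h : ∀ i < p, s i = t i) :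
    LexLt s t ↔ LexLt (shift p s) (shift p t) := by
  constructor
  · rintro ⟨i, hi, hi'⟩
    have hpi : p ≤ i := by
      by_contra! hip
      exact hi'.ne (h i hip)
    refine ⟨i - p, fun j hj => hi _ (by omega), ?_⟩
    simpa [shift, Nat.add_sub_cancel' hpi] using hi'
  · rintro ⟨i, hi, hi'⟩
    refine ⟨p + i, fun j hj => ?_, hi'⟩
    rcases lt_or_ge j p with hjp | hjp
    · exact h j hjp
    · simpa [shift, Nat.add_sub_cancel' hjp] using hi (j - p) (by omega)

theorem Aperiodic.shift_injective (h : Aperiodic u) : Function.Injective fun n => shift n u := by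
  have key : ∀ i j, i < j → shift i u ≠ shift j u := by
    intro i j hij e
    refine h ⟨j - i, by omega, i, fun n hn => ?_⟩
    have := congrFun e (n - i)
    simp only [shift] at this
    rw [show n + (j - i) = j + (n - i) by omega, ← this, show i + (n - i) = n by omega]
  intro i j e
  by_contra hne
  rcases lt_or_gt_of_ne hne with hlt | hlt
  · exact key i j hlt e
  · exact key j i hlt e.symm

theorem Aperiodic.lexLt_or_lexLt (h : Aperiodic u) {i j : ℕ} (hij : i ≠ j) :
    LexLt (shift i u) (shift j u) ∨ LexLt (shift j u) (shift i u) :=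
  lexLt_or_lexLt_of_ne fun e => hij (h.shift_injective e)

/-! ### The order of positions in blocks -/

theorem blockStart_shift (m n : ℕ) :
    blockStart φ u m + blockStart φ (shift m u) n = blockStart φ u (m + n) := by
  rw [blockStart, blockStart, blockStart, Finset.sum_range_add]
  rfl

theorem isImage_shift (h : IsPrimitiveMorphism φ) (hfix : IsFixedPoint φ u) (m : ℕ) :
    IsImage φ (shift m u) (shift (blockStart φ u m) u) := by
  refine ⟨(h.blockStart_strictMono (shift m u)).tendsto_atTop, fun n p => ?_⟩
  simp only [shift]
  rw [← add_assoc, blockStart_shift]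
  exact hfix.apply_add (m + n) p

theorem lexLt_shift_blockStart_iff (h : IsPrimitiveMorphism φ) (hmono : IsMonotoneMorphism φ)
    (hfix : IsFixedPoint φ u) (m m' : ℕ) :
    LexLt (shift (blockStart φ u m) u) (shift (blockStart φ u m') u) ↔
      LexLt (shift m u) (shift m' u) := by
  -- Monotonicity concerns positive shifts only. With one letter prepended, every shift of u,
  -- including u itself, becomes a positive shift.
  have e : ∀ m, shift (m + 1) (fun i => Nat.casesOn i (u 0) u : ℕ → Fin q) = shift m u := by
    intro m
    ext i
    simp only [shift, show m + 1 + i = (m + i) + 1 by omega]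
  have := hmono (fun i => Nat.casesOn i (u 0) u) (m + 1) m.succ_pos (m' + 1) m'.succ_pos
    (shift (blockStart φ u m) u) (shift (blockStart φ u m') u)
  rw [e, e] at this
  exact (this (isImage_shift h hfix m) (isImage_shift h hfix m')).symm

/-- The two blocks are equal, so their common prefix of length p can be removed without changing the
order. -/
theorem lexLt_shift_blockStart_add_iff (h : IsPrimitiveMorphism φ) (hmono : IsMonotoneMorphism φ)
    (hfix : IsFixedPoint φ u) {m m' p : ℕ} (hm : u m = u m') (hp : p < (φ (u m)).length) :
    LexLt (shift (blockStart φ u m + p) u) (shift (blockStart φ u m' + p) u) ↔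
      LexLt (shift m u) (shift m' u) := by
  rw [← lexLt_shift_blockStart_iff h hmono hfix m m', ← shift_shift, ← shift_shift,
    ← lexLt_iff_of_prefix_eq]
  intro i hi
  have h1 := hfix.apply_add m ⟨i, hi.trans hp⟩
  have h2 := hfix.apply_add m' ⟨i, hm ▸ hi.trans hp⟩
  simp only [shift]
  simp only [List.get_eq_getElem] at h1 h2
  rw [h1, h2]
  simp [hm]

theorem IsPrimitiveMorphism.exists_hasType (h : IsPrimitiveMorphism φ) (u : ℕ → Fin q) (k : ℕ) :
    ∃ τ, HasType φ u k τ := by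
  obtain ⟨m, p, e⟩ := h.exists_position u k
  exact ⟨⟨u m, p⟩, m, rfl, e⟩

theorem IsPrimitiveMorphism.hasType_unique (h : IsPrimitiveMorphism φ) {k : ℕ} {τ σ : PosType φ}
    (hτ : HasType φ u k τ) (hσ : HasType φ u k σ) : τ = σ := by
  obtain ⟨m, h1, h2⟩ := hτ
  obtain ⟨m', h1', h2'⟩ := hσ
  obtain ⟨a, p⟩ := τ
  obtain ⟨b, r⟩ := σ
  dsimp only at h1 h2 h1' h2'
  subst h1 h1'
  obtain ⟨rfl, e⟩ := h.position_unique p.2 r.2 (h2.symm.trans h2')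
  rw [Fin.ext e]

theorem HasType.apply_eq (hfix : IsFixedPoint φ u) {k : ℕ} {τ : PosType φ}
    (h : HasType φ u k τ) : u k = (φ τ.1).get τ.2 := by
  obtain ⟨m, h1, rfl⟩ := h
  obtain ⟨a, p⟩ := τ
  dsimp only at h1
  subst h1
  exact hfix.apply_add m p

theorem typeLt_iff (hsep : Separable φ u) {τ σ : PosType φ} (hne : τ ≠ σ) {n m : ℕ}
    (hn : HasType φ u n τ) (hm : HasType φ u m σ) :
    TypeLt φ u τ σ ↔ LexLt (shift n u) (shift m u) := by
  constructor
  · rintro ⟨-, n', m', hn', hm', hlt⟩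
    exact (hsep τ σ hne n' m' n m hn' hm' hn hm).mp hlt
  · exact fun hlt => ⟨hne, n, m, hn, hm, hlt⟩

open Classical in
theorem lexLt_shift_iff_type (h : IsPrimitiveMorphism φ) (hmono : IsMonotoneMorphism φ)
    (hfix : IsFixedPoint φ u) (hsep : Separable φ u) (m : ℕ) (p : Fin (φ (u m)).length) (x : ℕ) :
    LexLt (shift x u) (shift (blockStart φ u m + p) u) ↔
      (∃ σ ∈ Finset.univ.filter (fun σ => TypeLt φ u σ ⟨u m, p⟩), HasType φ u x σ) ∨
        blockImage φ u (fun m' => u m' = u m ∧ LexLt (shift m' u) (shift m u)) p x := by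
  have hk : HasType φ u (blockStart φ u m + p) ⟨u m, p⟩ := ⟨m, rfl, rfl⟩
  simp only [Finset.mem_filter, Finset.mem_univ, true_and]
  constructor
  · intro hlt
    obtain ⟨σ, hσ⟩ := h.exists_hasType u x
    by_cases hne : σ = ⟨u m, p⟩
    · subst hne
      obtain ⟨m', hm', rfl⟩ := hσ
      dsimp only at hm' hlt
      exact Or.inr ⟨m', ⟨hm', (lexLt_shift_blockStart_add_iff h hmono hfix hm'
        (by rw [hm']; exact p.2)).mp hlt⟩, rfl⟩
    · exact Or.inl ⟨σ, (typeLt_iff hsep hne hσ hk).mpr hlt, hσ⟩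
  · rintro (⟨σ, hσ, hx⟩ | ⟨m', ⟨hm', hlt⟩, rfl⟩)
    · exact (typeLt_iff hsep hσ.1 hx hk).mp hσ
    · exact (lexLt_shift_blockStart_add_iff h hmono hfix hm' (by rw [hm']; exact p.2)).mpr hlt

theorem lexLt_of_head_lt {s t : ℕ → Fin q} (h : s 0 < t 0) : LexLt s t :=
  ⟨0, fun _ hj => absurd hj (Nat.not_lt_zero _), h⟩

theorem LexLt.head_le {s t : ℕ → Fin q} (h : LexLt s t) : s 0 ≤ t 0 := by
  obtain ⟨i, hi, hi'⟩ := h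
  rcases Nat.eq_zero_or_pos i with rfl | h0
  · exact hi'.le
  · exact (hi 0 h0).le

theorem lexLt_shift_iff_letter (m x : ℕ) :
    LexLt (shift x u) (shift m u) ↔
      (∃ c ∈ Finset.univ.filter (· < u m), u x = c) ∨
        (u x = u m ∧ LexLt (shift x u) (shift m u)) := by
  simp only [Finset.mem_filter, Finset.mem_univ, true_and, exists_eq_right']
  constructor
  · intro h
    rcases h.head_le.lt_or_eq with h1 | h1
    · exact Or.inl (by simpa [shift] using h1)
    · exact Or.inr ⟨by simpa [shift] using h1, h⟩
  · rintro (h | h)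
    · exact lexLt_of_head_lt (by simpa [shift] using h)
    · exact h.2

/-! ### The frequencies of the sets of smaller shifts -/

/-- `μ` is the vector of the uniform frequencies of letters, and a positive eigenvector with
the eigenvalue `θ > 1`. -/
structure IsFrequencyVector (φ : Fin q → List (Fin q)) (u : ℕ → Fin q) (μ : Fin q → ℝ) (θ : ℝ) :
    Prop where
  one_lt : 1 < θ
  pos : ∀ b, 0 < μ b
  sum_eq_one : ∑ b, μ b = 1
  eigen : (morphismMatrix ℝ φ).mulVec μ = θ • μ
  slope : ∀ b, HasSlope (countBelow fun n => u n = b) (μ b) 0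

variable {μ : Fin q → ℝ} {θ : ℝ}

theorem IsFrequencyVector.theta_pos (hμ : IsFrequencyVector φ u μ θ) : 0 < θ :=
  one_pos.trans hμ.one_lt

theorem IsFrequencyVector.exists_apply_eq (hμ : IsFrequencyVector φ u μ θ) (b : Fin q) :
    ∃ m, u m = b := by
  by_contra! hcon
  have h1 := hμ.slope b
  have : (countBelow fun n => u n = b) = fun _ => 0 := by
    ext k
    simp [countBelow, hcon]
  rw [this] at h1
  exact (hμ.pos b).ne' (h1.unique hasSlope_zero)

theorem IsFrequencyVector.slope_blockStart (hμ : IsFrequencyVector φ u μ θ) :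
    HasSlope (fun m => (blockStart φ u m : ℝ)) θ 0 :=
  hasSlope_blockStart hμ.sum_eq_one hμ.eigen hμ.slope

theorem IsFrequencyVector.slope_hasType (hμ : IsFrequencyVector φ u μ θ)
    (h : IsPrimitiveMorphism φ) (τ : PosType φ) :
    HasSlope (countBelow fun k => HasType φ u k τ) (μ τ.1 / θ) 0 := by
  have := (hμ.slope τ.1).blockImage h hμ.theta_pos hμ.slope_blockStart (p := τ.2)
    (fun m hm => by rw [hm]; exact τ.2.2) le_rfl
  rwa [zero_div] at this

/-- All the maps contract by the same factor 1 / θ, as the intervals have lengths μ and μ / θ. -/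
theorem psiMap_eq (hμ : IsFrequencyVector φ u μ θ) (τ : PosType φ) (x : ℝ) :
    psiMap φ u μ θ τ x = (x - loI μ τ.1) / θ + loJ φ u μ θ τ := by
  have h1 := (hμ.pos τ.1).ne'
  have h2 := hμ.theta_pos.ne'
  rw [psiMap, hiJ, hiI, add_sub_cancel_left, add_sub_cancel_left]
  field_simp

theorem slope_smaller_same_letter (hμ : IsFrequencyVector φ u μ θ) {m : ℕ} {r ε : ℝ}
    (hr : HasSlope (countBelow fun x => LexLt (shift x u) (shift m u)) r ε) :
    HasSlope (countBelow fun x => u x = u m ∧ LexLt (shift x u) (shift m u))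
      (r - loI μ (u m)) ε := by
  have h1 : HasSlope (fun k => ∑ c ∈ Finset.univ.filter (· < u m), countBelow (fun n => u n = c) k)
      (loI μ (u m)) 0 := HasSlope.sum _ fun c _ => hμ.slope c
  refine (hr.sub h1).of_bounded_sub (B := 0) fun k => ?_
  have e : (fun x => LexLt (shift x u) (shift m u)) = fun x =>
      (∃ c ∈ Finset.univ.filter (· < u m), u x = c) ∨
        (u x = u m ∧ LexLt (shift x u) (shift m u)) :=
    funext fun x => propext (lexLt_shift_iff_letter m x)
  rw [← countBelow_exists _ (fun a _ b _ x h1 h2 => h1.symm.trans h2)]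
  conv_lhs => rw [e]
  rw [countBelow_or]
  · simp
  · rintro x ⟨c, hc, rfl⟩ ⟨hx, -⟩
    rw [Finset.mem_filter, hx] at hc
    exact lt_irrefl _ hc.2

theorem slope_smaller_block (h : IsPrimitiveMorphism φ) (hmono : IsMonotoneMorphism φ)
    (hfix : IsFixedPoint φ u) (hsep : Separable φ u) (hμ : IsFrequencyVector φ u μ θ) {m : ℕ}
    (p : Fin (φ (u m)).length) {r ε : ℝ} (hε : 0 ≤ ε)
    (hr : HasSlope (countBelow fun x => LexLt (shift x u) (shift m u)) r ε) :
    HasSlope (countBelow fun x => LexLt (shift x u) (shift (blockStart φ u m + p) u))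
      (psiMap φ u μ θ ⟨u m, p⟩ r) (ε / θ) := by
  classical
  have h1 : HasSlope (fun k => ∑ σ ∈ Finset.univ.filter (fun σ => TypeLt φ u σ ⟨u m, p⟩),
      countBelow (fun k => HasType φ u k σ) k) (loJ φ u μ θ ⟨u m, p⟩) 0 :=
    HasSlope.sum _ fun σ _ => hμ.slope_hasType h σ
  have h2 := (slope_smaller_same_letter hμ hr).blockImage h hμ.theta_pos hμ.slope_blockStart
    (p := p) (fun m' hm' => by rw [hm'.1]; exact p.2) hε
  have h3 := h2.add h1
  rw [add_zero, ← psiMap_eq hμ ⟨u m, p⟩] at h3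
  convert h3 using 2 with k
  have e : (fun x => LexLt (shift x u) (shift (blockStart φ u m + p) u)) = _ :=
    funext fun x => propext (lexLt_shift_iff_type h hmono hfix hsep m p x)
  rw [e, countBelow_or, countBelow_exists, add_comm]
  · exact fun a _ b _ x ha hb => h.hasType_unique ha hb
  · rintro x ⟨σ, hσ, hx⟩ ⟨m', ⟨hm', -⟩, rfl⟩
    exact (Finset.mem_filter.mp hσ).2.1 (h.hasType_unique hx ⟨m', hm', rfl⟩)

/-- The value `a k` is the uniform frequency of the shifts smaller than `T^k u`. -/
def IsRankFunction (u : ℕ → Fin q) (a : ℕ → ℝ) : Prop :=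
  ∀ k, HasSlope (countBelow fun x => LexLt (shift x u) (shift k u)) (a k) 0

theorem exists_isRankFunction (h : IsPrimitiveMorphism φ) (hmono : IsMonotoneMorphism φ)
    (hfix : IsFixedPoint φ u) (hsep : Separable φ u) (hμ : IsFrequencyVector φ u μ θ) :
    ∃ a, IsRankFunction u a := by
  have key : ∀ n k : ℕ, ∃ r,
      HasSlope (countBelow fun x => LexLt (shift x u) (shift k u)) r (θ⁻¹ ^ n) := by
    intro n
    induction n with
    | zero =>
      intro k
      -- A count lies between 0 and the window length, so the slope 0 is correct up to the error 1.
      refine ⟨0, fun ε' hε' => ⟨0, fun i j hij => ?_⟩⟩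
      rw [pow_zero] at hε'
      rw [zero_mul, sub_zero, abs_of_nonneg (countBelow_sub_nonneg _ hij), add_zero]
      exact (countBelow_sub_le _ hij).trans
        (le_mul_of_one_le_left (cast_sub_nonneg hij) hε'.le)
    | succ n ih =>
      intro k
      obtain ⟨m, p, rfl⟩ := h.exists_position u k
      obtain ⟨r, hr⟩ := ih m
      refine ⟨_, (slope_smaller_block h hmono hfix hsep hμ p
        (pow_nonneg (inv_nonneg.mpr hμ.theta_pos.le) n) hr).mono ?_⟩
      rw [pow_succ, div_eq_mul_inv]
  have hlim : Tendsto (fun n : ℕ => θ⁻¹ ^ n) atTop (𝓝 0) :=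
    tendsto_pow_atTop_nhds_zero_of_lt_one (inv_nonneg.mpr hμ.theta_pos.le)
      (inv_lt_one_of_one_lt₀ hμ.one_lt)
  choose a ha using fun k => exists_hasSlope_of_tendsto_zero hlim fun n => key n k
  exact ⟨a, ha⟩

theorem IsRankFunction.apply_block {a : ℕ → ℝ} (ha : IsRankFunction u a)
    (h : IsPrimitiveMorphism φ) (hmono : IsMonotoneMorphism φ)
    (hfix : IsFixedPoint φ u) (hsep : Separable φ u) (hμ : IsFrequencyVector φ u μ θ) (m : ℕ)
    (p : Fin (φ (u m)).length) :
    a (blockStart φ u m + p) = psiMap φ u μ θ ⟨u m, p⟩ (a m) := by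
  have := slope_smaller_block h hmono hfix hsep hμ p le_rfl (ha m)
  rw [zero_div] at this
  exact (ha _).unique this

/-! ### Existence of the frequency vector -/

/-- If the image of u 0 had length 1, it would be u 0 itself; the unit vector of u 0 would be fixed
by the matrix, and primitivity would leave a single letter. -/
theorem two_le_length_of_aperiodic (h : IsPrimitiveMorphism φ) (hfix : IsFixedPoint φ u)
    (haper : Aperiodic u) : 2 ≤ (φ (u 0)).length := by
  by_contra! hlt
  have hpos := h.length_pos (u 0)
  obtain ⟨c, hc⟩ := List.length_eq_one_iff.mp (show (φ (u 0)).length = 1 by omega)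
  have h0 : u 0 = c := by
    have := hfix.apply_add 0 ⟨0, hpos⟩
    simpa [blockStart_zero, hc] using this
  rw [← h0] at hc
  have hcol : (morphismMatrix ℝ φ).mulVec (Pi.single (u 0) 1) = (1 : ℝ) • Pi.single (u 0) 1 := by
    ext b
    rw [one_smul, Matrix.mulVec_single_one]
    simp only [Matrix.col_apply, morphismMatrix_apply, hc, Pi.single_apply]
    rcases eq_or_ne b (u 0) with rfl | hb
    · simp
    · simp [hb, hb.symm]
  obtain ⟨-, k, -, hk⟩ := h
  have hcol' := pow_mulVec_of_eigen hcol k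
  have hall : ∀ b, b = u 0 := by
    intro b
    by_contra hb
    have h1 := congrFun hcol' b
    rw [Matrix.mulVec_single_one] at h1
    simp [hb] at h1
    exact (hk b (u 0)).ne' h1
  exact haper ⟨1, one_pos, 0, fun n _ => (hall _).trans (hall _).symm⟩

theorem exists_isFrequencyVector (h : IsPrimitiveMorphism φ) (hfix : IsFixedPoint φ u)
    (haper : Aperiodic u) : ∃ μ θ, IsFrequencyVector φ u μ θ := by
  have : Nonempty (Fin q) := ⟨u 0⟩
  obtain ⟨μ, θ, hθ, hμ, hμ1, heig⟩ := exists_pos_eigenvector h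
  refine ⟨μ, θ, ?_, hμ, hμ1, heig, hasSlope_letterCount h hfix hθ hμ hμ1 heig⟩
  rw [← hμ1, ← sum_length_mul_eq hμ1 heig]
  refine Finset.sum_lt_sum (fun a _ => ?_) ⟨u 0, Finset.mem_univ _, ?_⟩
  · have : (1 : ℝ) ≤ (φ a).length := by exact_mod_cast h.length_pos a
    exact le_mul_of_one_le_left (hμ a).le this
  · have : (2 : ℝ) ≤ (φ (u 0)).length := by exact_mod_cast two_le_length_of_aperiodic h hfix haper
    nlinarith [hμ (u 0)]

theorem IsFrequencyVector.isPerronFrobenius (hμ : IsFrequencyVector φ u μ θ)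
    (h : IsPrimitiveMorphism φ) : IsPerronFrobenius φ θ := by
  have hmap : morphismMatrix ℂ φ = (morphismMatrix ℝ φ).map (algebraMap ℝ ℂ) := by
    ext a b
    simp [morphismMatrix]
  refine ⟨hμ.theta_pos, ?_, fun z hz hne => ?_⟩
  · refine Module.End.hasEigenvalue_of_hasEigenvector (x := fun b => (μ b : ℂ)) ⟨?_, ?_⟩
    · rw [Module.End.mem_eigenspace_iff, Matrix.toLin'_apply]
      ext b
      have := congrFun hμ.eigen b
      simp only [Matrix.mulVec, dotProduct, Pi.smul_apply, smul_eq_mul] at this ⊢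
      rw [hmap]
      simp only [Matrix.map_apply, Complex.coe_algebraMap]
      exact_mod_cast this
    · intro h0
      exact (hμ.pos (u 0)).ne' (by simpa using congrFun h0 (u 0))
  · obtain ⟨v, hv⟩ := hz.exists_hasEigenvector
    have hv1 := hv.apply_eq_smul
    rw [Matrix.toLin'_apply, hmap] at hv1
    exact norm_lt_of_eigenvalue h hμ.theta_pos hμ.pos hμ.eigen hv.2 hv1 hne

/-! ### Recurrence of factors -/

theorem lt_blockStart (h : IsPrimitiveMorphism φ) (hfix : IsFixedPoint φ u)
    (haper : Aperiodic u) {m : ℕ} (hm : 0 < m) : m < blockStart φ u m := by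
  obtain ⟨m, rfl⟩ := Nat.exists_eq_succ_of_ne_zero hm.ne'
  induction m with
  | zero =>
    rw [Nat.succ_eq_add_one, blockStart_succ, blockStart_zero]
    have := two_le_length_of_aperiodic h hfix haper
    omega
  | succ m ih =>
    have h1 : m + 1 < blockStart φ u (m + 1) := ih m.succ_pos
    have h2 : blockStart φ u (m + 1) < blockStart φ u (m + 1 + 1) :=
      h.blockStart_strictMono u (Nat.lt_succ_self _)
    exact Nat.lt_of_le_of_lt h1 h2

theorem prefix_blockStart (h : IsPrimitiveMorphism φ) (hfix : IsFixedPoint φ u) {k l : ℕ}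
    (hk : ∀ i < l, u (k + i) = u i) : ∀ i < blockStart φ u l, u (blockStart φ u k + i) = u i := by
  intro i hi
  obtain ⟨m, p, rfl⟩ := h.exists_position u i
  have hml : m < l := (h.blockStart_strictMono u).lt_iff_lt.mp (by omega)
  have e : blockStart φ u k + blockStart φ u m = blockStart φ u (k + m) := by
    rw [← blockStart_shift k m]
    congr 1
    refine Finset.sum_congr rfl fun x hx => ?_
    rw [shift, hk x ((Finset.mem_range.mp hx).trans hml)]
  have h1 := hfix.apply_add (k + m) ⟨p, by rw [hk m hml]; exact p.2⟩
  have h2 := hfix.apply_add m p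
  rw [← add_assoc, e, h2]
  refine h1.trans ?_
  simp [hk m hml]

/-- Applying φ to occurrences of a prefix yields occurrences of a longer prefix, with the frequency
divided by θ but still positive. -/
theorem exists_slope_prefix (h : IsPrimitiveMorphism φ) (hfix : IsFixedPoint φ u)
    (haper : Aperiodic u) (hμ : IsFrequencyVector φ u μ θ) (l : ℕ) :
    ∃ (S : ℕ → Prop) (r : ℝ), 0 < r ∧ HasSlope (countBelow S) r 0 ∧
      ∀ k, S k → ∀ i < l + 1, u (k + i) = u i := by
  induction l with
  | zero =>
    refine ⟨fun k => u k = u 0, μ (u 0), hμ.pos _, hμ.slope _, fun k hk i hi => ?_⟩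
    obtain rfl : i = 0 := by omega
    exact hk
  | succ l ih =>
    obtain ⟨S, r, hr, hS, hpre⟩ := ih
    have := hS.blockImage h hμ.theta_pos hμ.slope_blockStart (p := 0)
      (fun m _ => h.length_pos _) le_rfl
    rw [zero_div] at this
    refine ⟨_, _, div_pos hr hμ.theta_pos, this, ?_⟩
    rintro k ⟨m, hm, rfl⟩ i hi
    have : l + 1 < blockStart φ u (l + 1) := lt_blockStart h hfix haper l.succ_pos
    exact prefix_blockStart h hfix (hpre m hm) i (by omega)

/-- Every factor of `u` occurs with positive lower density. -/
theorem exists_density_factor (h : IsPrimitiveMorphism φ) (hfix : IsFixedPoint φ u)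
    (haper : Aperiodic u) (hμ : IsFrequencyVector φ u μ θ) (k l : ℕ) :
    ∃ c C : ℝ, 0 < c ∧ ∀ n : ℕ,
      c * n ≤ countBelow (fun m => ∀ i < l, u (m + i) = u (k + i)) n + C := by
  classical
  obtain ⟨S, r, hr, hS, hpre⟩ := exists_slope_prefix h hfix haper hμ (k + l)
  obtain ⟨C, hC⟩ := hS (r / 2) (half_pos hr)
  refine ⟨r / 2, C + k, half_pos hr, fun n => ?_⟩
  set R : ℕ → Prop := fun m => ∀ i < l, u (m + i) = u (k + i) with hR
  have h1 := (abs_le.mp (hC 0 n n.zero_le)).1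
  have h2 := countBelow_sub_le R (Nat.le_add_left n k)
  -- The factor at k lies within the prefix of length k + l, so each occurrence x of that prefix
  -- gives an occurrence k + x of the factor.
  have h3 : countBelow S n ≤ countBelow R (k + n) := by
    rw [countBelow, countBelow, Finset.sum_range_add]
    refine le_add_of_nonneg_of_le (Finset.sum_nonneg fun x _ => by positivity)
      (Finset.sum_le_sum fun x _ => ?_)
    by_cases hx : S x
    · rw [if_pos hx, if_pos]
      intro i hi
      rw [add_comm k x, add_assoc]
      exact hpre x hx (k + i) (by omega)
    · rw [if_neg hx]
      positivity
  rw [countBelow_zero] at h1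
  push_cast at h1 h2
  linarith

/-- A prefix occurs with positive density, which the position 0 alone cannot provide. -/
theorem exists_pos_prefix (h : IsPrimitiveMorphism φ) (hfix : IsFixedPoint φ u)
    (haper : Aperiodic u) (hμ : IsFrequencyVector φ u μ θ) (l : ℕ) :
    ∃ m > 0, ∀ i < l, u (m + i) = u i := by
  classical
  by_contra! hcon
  obtain ⟨c, C, hc, hcC⟩ := exists_density_factor h hfix haper hμ 0 l
  refine hc.not_ge (nonpos_of_mul_nat_le (C := 1 + C) fun n => (hcC n).trans ?_)
  refine add_le_add_left ?_ C
  calc _ ≤ countBelow (fun m => m = 0) n := by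
        have := countBelow_mono_sub (S := fun m => ∀ i < l, u (m + i) = u (0 + i))
          (R := fun m => m = 0) (fun m hm => ?_) n.zero_le
        · simpa [countBelow_zero] using this
        · by_contra hm0
          obtain ⟨i, hi, hne⟩ := hcon m (Nat.pos_of_ne_zero hm0)
          exact hne (by simpa using hm i hi)
    _ ≤ 1 := by
        cases n <;> simp [countBelow, Finset.sum_range_succ']

/-! ### Extremal shifts and the rank function -/

/-- If `u` has a shift that is the greatest one among the shifts starting with some factor, then
it has no shift that is the least one in this sense. -/
theorem exists_smaller_of_containsMax (h : IsPrimitiveMorphism φ) (hfix : IsFixedPoint φ u)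
    (haper : Aperiodic u) (hμ : IsFrequencyVector φ u μ θ) (hmax : ContainsMax u) (k l : ℕ) :
    ∃ m, (∀ i < l, u (m + i) = u (k + i)) ∧ LexLt (shift m u) (shift k u) := by
  by_contra! hmin
  obtain ⟨k', l', hmax⟩ := hmax
  -- The recurring prefix covers both factors. If u < T^m u, then the shift at m + k' exceeds the
  -- locally greatest one; otherwise the shift at m + k is below the locally least one.
  obtain ⟨m, hm0, hm⟩ := exists_pos_prefix h hfix haper hμ (max (k + l) (k' + l'))
  have hshift : ∀ j ≤ max (k + l) (k' + l'),
      (LexLt (shift 0 u) (shift m u) ↔ LexLt (shift j u) (shift (m + j) u)) ∧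
      (LexLt (shift m u) (shift 0 u) ↔ LexLt (shift (m + j) u) (shift j u)) := by
    intro j hj
    have e : ∀ i < j, shift 0 u i = shift m u i := fun i hi => by
      simp [shift, hm i (by omega)]
    have h1 := lexLt_iff_of_prefix_eq e
    have h2 := lexLt_iff_of_prefix_eq fun i hi => (e i hi).symm
    rw [shift_shift, shift_shift, zero_add] at h1 h2
    exact ⟨h1, h2⟩
  rcases haper.lexLt_or_lexLt hm0.ne with hlt | hlt
  · refine hmax (m + k') (fun i hi => ?_) ((hshift k' (by omega)).1.mp hlt)
    rw [add_assoc]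
    exact hm _ (by omega)
  · refine hmin (m + k) (fun i hi => ?_) ((hshift k (by omega)).2.mp hlt)
    rw [add_assoc]
    exact hm _ (by omega)

theorem LexLt.exists_prefix_left {s t : ℕ → Fin q} (h : LexLt s t) :
    ∃ d, ∀ w : ℕ → Fin q, (∀ i < d, w i = s i) → LexLt w t := by
  obtain ⟨d, hd, hlt⟩ := h
  exact ⟨d + 1, fun w hw => ⟨d, fun j hj => (hw j (by omega)).trans (hd j hj),
    (hw d (by omega)).symm ▸ hlt⟩⟩

theorem LexLt.exists_prefix_right {s t : ℕ → Fin q} (h : LexLt s t) :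
    ∃ d, ∀ w : ℕ → Fin q, (∀ i < d, w i = t i) → LexLt s w := by
  obtain ⟨d, hd, hlt⟩ := h
  exact ⟨d + 1, fun w hw => ⟨d, fun j hj => (hd j hj).trans (hw j (by omega)).symm,
    (hw d (by omega)).symm ▸ hlt⟩⟩

/-- With nothing in between, T^i u would be the greatest shift with some prefix and T^j u the least
one with some prefix. -/
theorem exists_between (h : IsPrimitiveMorphism φ) (hfix : IsFixedPoint φ u)
    (haper : Aperiodic u) (hμ : IsFrequencyVector φ u μ θ) {i j : ℕ}
    (hij : LexLt (shift i u) (shift j u)) :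
    ∃ k, LexLt (shift i u) (shift k u) ∧ LexLt (shift k u) (shift j u) := by
  by_contra! hcon
  obtain ⟨d, hd⟩ := hij.exists_prefix_left
  obtain ⟨e, he⟩ := hij.exists_prefix_right
  obtain ⟨m, hm, hlt⟩ := exists_smaller_of_containsMax h hfix haper hμ
    ⟨i, d, fun m hm hlt => hcon m hlt (hd _ hm)⟩ j e
  exact hcon m (he _ hm) hlt

/-- Some shift lies strictly between, together with all shifts sharing a long enough prefix with it;
these have positive lower density, which separates the two ranks. -/
theorem IsRankFunction.lt_of_lexLt {a : ℕ → ℝ} (ha : IsRankFunction u a)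
    (h : IsPrimitiveMorphism φ) (hfix : IsFixedPoint φ u) (haper : Aperiodic u)
    (hμ : IsFrequencyVector φ u μ θ) {i j : ℕ} (hij : LexLt (shift i u) (shift j u)) :
    a i < a j := by
  obtain ⟨k, hik, hkj⟩ := exists_between h hfix haper hμ hij
  obtain ⟨d, hd⟩ := hkj.exists_prefix_left
  obtain ⟨e, he⟩ := hik.exists_prefix_right
  obtain ⟨c, C, hc, hcC⟩ := exists_density_factor h hfix haper hμ k (max d e)
  have := (ha i).le_of_increments (ha j) (c := c) (C := C) fun n => ?_
  · linarith
  · set R : ℕ → Prop := fun m => ∀ i < max d e, u (m + i) = u (k + i)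
    have h1 : countBelow (fun x => LexLt (shift x u) (shift i u) ∨ R x) n =
        countBelow (fun x => LexLt (shift x u) (shift i u)) n + countBelow R n :=
      countBelow_or (fun x hx hR => hx.asymm (he _ fun t ht => hR t (by omega))) n
    have h2 := countBelow_mono_sub (S := fun x => LexLt (shift x u) (shift i u) ∨ R x)
      (R := fun x => LexLt (shift x u) (shift j u)) (fun x hx => ?_) n.zero_le
    · have := hcC n
      simp only [countBelow_zero, sub_zero] at h2 ⊢
      linarith
    · rcases hx with hx | hx
      · exact hx.trans hij
      · exact hd _ fun t ht => hx t (by omega)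

theorem IsRankFunction.lt_iff {a : ℕ → ℝ} (ha : IsRankFunction u a)
    (h : IsPrimitiveMorphism φ) (hfix : IsFixedPoint φ u) (haper : Aperiodic u)
    (hμ : IsFrequencyVector φ u μ θ) (i j : ℕ) :
    a i < a j ↔ LexLt (shift i u) (shift j u) := by
  refine ⟨fun hlt => ?_, ha.lt_of_lexLt h hfix haper hμ⟩
  rcases eq_or_ne i j with rfl | hne
  · exact absurd hlt (lt_irrefl _)
  · exact (haper.lexLt_or_lexLt hne).resolve_right fun hji =>
      hlt.asymm (ha.lt_of_lexLt h hfix haper hμ hji)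

theorem IsRankFunction.injective {a : ℕ → ℝ} (ha : IsRankFunction u a)
    (h : IsPrimitiveMorphism φ) (hfix : IsFixedPoint φ u) (haper : Aperiodic u)
    (hμ : IsFrequencyVector φ u μ θ) : Function.Injective a := by
  intro i j e
  by_contra hne
  rcases haper.lexLt_or_lexLt hne with hlt | hlt
  · exact (ha.lt_of_lexLt h hfix haper hμ hlt).ne e
  · exact (ha.lt_of_lexLt h hfix haper hμ hlt).ne e.symm

/-! ### The intervals -/

theorem HasSlope.le_of_imp {S R : ℕ → Prop} {r s : ℝ} (hS : HasSlope (countBelow S) r 0)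
    (hR : HasSlope (countBelow R) s 0) (h : ∀ x, S x → R x) : r ≤ s := by
  have := hS.le_of_increments hR (c := 0) (C := 0) fun n => by
    simpa using countBelow_mono_sub h n.zero_le
  linarith

theorem hasSlope_true : HasSlope (countBelow fun _ => True) 1 0 := fun ε hε =>
  ⟨0, fun i j hij => by
    simpa [countBelow_true] using mul_nonneg hε.le (cast_sub_nonneg hij)⟩

theorem hasSlope_false : HasSlope (countBelow fun _ => False) 0 0 := by
  have : (countBelow fun _ => False) = fun _ => 0 := funext countBelow_false
  rw [this]
  exact hasSlope_zero

theorem IsFrequencyVector.slope_lt (hμ : IsFrequencyVector φ u μ θ) (b : Fin q) :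
    HasSlope (countBelow fun x => u x < b) (loI μ b) 0 := by
  have h1 : HasSlope (fun k => ∑ c ∈ Finset.univ.filter (· < b), countBelow (fun n => u n = c) k)
      (loI μ b) 0 := HasSlope.sum _ fun c _ => hμ.slope c
  convert h1 using 2 with k
  rw [← countBelow_exists _ (fun a _ b _ x h1 h2 => h1.symm.trans h2)]
  simp

theorem IsFrequencyVector.slope_le (hμ : IsFrequencyVector φ u μ θ) (b : Fin q) :
    HasSlope (countBelow fun x => u x ≤ b) (hiI μ b) 0 := by
  have h1 := (hμ.slope_lt b).add (hμ.slope b)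
  rw [add_zero, ← hiI] at h1
  convert h1 using 2 with k
  rw [← countBelow_or fun x hx => hx.ne]
  simp only [le_iff_lt_or_eq]

theorem IsFrequencyVector.loI_nonneg (hμ : IsFrequencyVector φ u μ θ) (b : Fin q) :
    0 ≤ loI μ b := hasSlope_false.le_of_imp (hμ.slope_lt b) fun _ => False.elim

theorem IsFrequencyVector.hiI_le_one (hμ : IsFrequencyVector φ u μ θ) (b : Fin q) :
    hiI μ b ≤ 1 := (hμ.slope_le b).le_of_imp hasSlope_true fun _ _ => trivial

theorem IsFrequencyVector.hiI_le_loI (hμ : IsFrequencyVector φ u μ θ) {b c : Fin q}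
    (hbc : b < c) : hiI μ b ≤ loI μ c :=
  (hμ.slope_le b).le_of_imp (hμ.slope_lt c) fun _ hx => lt_of_le_of_lt hx hbc

theorem IsFrequencyVector.slope_typeLt (hμ : IsFrequencyVector φ u μ θ)
    (h : IsPrimitiveMorphism φ) (τ : PosType φ) :
    HasSlope (countBelow fun x => ∃ σ, TypeLt φ u σ τ ∧ HasType φ u x σ) (loJ φ u μ θ τ) 0 := by
  classical
  have h1 : HasSlope (fun k => ∑ σ ∈ Finset.univ.filter (fun σ => TypeLt φ u σ τ),
      countBelow (fun k => HasType φ u k σ) k) (loJ φ u μ θ τ) 0 :=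
    HasSlope.sum _ fun σ _ => hμ.slope_hasType h σ
  convert h1 using 2 with k
  rw [← countBelow_exists (S := fun σ k => HasType φ u k σ) _
    (fun a _ b _ x ha hb => h.hasType_unique ha hb)]
  simp

theorem IsFrequencyVector.slope_typeLe (hμ : IsFrequencyVector φ u μ θ)
    (h : IsPrimitiveMorphism φ) (τ : PosType φ) :
    HasSlope (countBelow fun x => (∃ σ, TypeLt φ u σ τ ∧ HasType φ u x σ) ∨ HasType φ u x τ)
      (hiJ φ u μ θ τ) 0 := by
  have h1 := (hμ.slope_typeLt h τ).add (hμ.slope_hasType h τ)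
  rw [add_zero, ← hiJ] at h1
  convert h1 using 2 with k
  rw [countBelow_or]
  rintro x ⟨σ, hσ, hx⟩ hx'
  exact hσ.1 (h.hasType_unique hx hx')

theorem IsFrequencyVector.exists_hasType (hμ : IsFrequencyVector φ u μ θ) (τ : PosType φ) :
    ∃ k, HasType φ u k τ := by
  obtain ⟨m, hm⟩ := hμ.exists_apply_eq τ.1
  exact ⟨_, m, hm, rfl⟩

/-- Ends of intervals are frequencies of sets of positions, so they are compared by inclusion: a
position with a smaller letter has a smaller type. -/
theorem IsFrequencyVector.loI_le_loJ (hμ : IsFrequencyVector φ u μ θ)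
    (h : IsPrimitiveMorphism φ) (hfix : IsFixedPoint φ u) (τ : PosType φ) :
    loI μ ((φ τ.1).get τ.2) ≤ loJ φ u μ θ τ := by
  refine (hμ.slope_lt _).le_of_imp (hμ.slope_typeLt h τ) fun x hx => ?_
  obtain ⟨σ, hσ⟩ := h.exists_hasType u x
  obtain ⟨k, hk⟩ := hμ.exists_hasType τ
  rw [← hk.apply_eq hfix] at hx
  refine ⟨σ, ⟨?_, x, k, hσ, hk, lexLt_of_head_lt (by simpa [shift] using hx)⟩, hσ⟩
  rintro rfl
  rw [hσ.apply_eq hfix, hk.apply_eq hfix] at hx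
  exact lt_irrefl _ hx

theorem IsFrequencyVector.hiJ_le_hiI (hμ : IsFrequencyVector φ u μ θ)
    (h : IsPrimitiveMorphism φ) (hfix : IsFixedPoint φ u) (τ : PosType φ) :
    hiJ φ u μ θ τ ≤ hiI μ ((φ τ.1).get τ.2) := by
  refine (hμ.slope_typeLe h τ).le_of_imp (hμ.slope_le _) ?_
  rintro x (⟨σ, ⟨-, n, m, hn, hm, hlt⟩, hx⟩ | hx)
  · have := hlt.head_le
    simp only [shift, add_zero] at this
    rwa [hn.apply_eq hfix, ← hx.apply_eq hfix, hm.apply_eq hfix] at this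
  · exact (hx.apply_eq hfix).le

theorem halfOpen_subset (u : ℕ → Fin q) {x y x' y' : ℝ} (hx : x' ≤ x) (hy : y ≤ y') :
    halfOpen u x y ⊆ halfOpen u x' y' := by
  unfold halfOpen
  split_ifs
  · exact Set.Ioc_subset_Ioc hx hy
  · exact Set.Ico_subset_Ico hx hy

theorem halfOpen_disjoint (u : ℕ → Fin q) {x y x' y' t : ℝ} (h : y ≤ x')
    (ht : t ∈ halfOpen u x y) : t ∉ halfOpen u x' y' := by
  unfold halfOpen at *
  split_ifs at *
  · exact fun ht' => (ht.2.trans h).not_gt ht'.1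
  · exact fun ht' => (ht.2.trans_le h).not_ge ht'.1

theorem IsFrequencyVector.eq_of_mem_intervalI (hμ : IsFrequencyVector φ u μ θ) {b c : Fin q}
    {t : ℝ} (hb : t ∈ intervalI u μ b) (hc : t ∈ intervalI u μ c) : b = c := by
  by_contra hne
  rcases lt_or_gt_of_ne hne with hlt | hlt
  · exact halfOpen_disjoint u (hμ.hiI_le_loI hlt) hb hc
  · exact halfOpen_disjoint u (hμ.hiI_le_loI hlt) hc hb

/-- Inclusions of sets give the closed interval. The open end is excluded because another shift with
the same first letter lies strictly closer to it, on the side where locally extremal shifts do not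
exist. -/
theorem IsRankFunction.mem_intervalI {a : ℕ → ℝ} (ha : IsRankFunction u a)
    (h : IsPrimitiveMorphism φ) (hfix : IsFixedPoint φ u) (haper : Aperiodic u)
    (hμ : IsFrequencyVector φ u μ θ) (i : ℕ) : a i ∈ intervalI u μ (u i) := by
  have hlo : ∀ k, loI μ (u k) ≤ a k := fun k =>
    (hμ.slope_lt (u k)).le_of_imp (ha k) fun x hx => lexLt_of_head_lt (by simpa [shift] using hx)
  have hhi : ∀ k, a k ≤ hiI μ (u k) := fun k =>
    (ha k).le_of_imp (hμ.slope_le (u k)) fun x hx => by simpa [shift] using hx.head_le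
  by_cases hmax : ContainsMax u
  · obtain ⟨m, hm, hlt⟩ := exists_smaller_of_containsMax h hfix haper hμ hmax i 1
    have e : u m = u i := hm 0 one_pos
    rw [intervalI, halfOpen, if_pos hmax]
    exact ⟨(e ▸ hlo m).trans_lt (ha.lt_of_lexLt h hfix haper hμ hlt), hhi i⟩
  · rw [intervalI, halfOpen, if_neg hmax]
    refine ⟨hlo i, ?_⟩
    unfold ContainsMax at hmax
    push Not at hmax
    obtain ⟨m, hm, hlt⟩ := hmax i 1
    have e : u m = u i := hm 0 one_pos
    exact (ha.lt_of_lexLt h hfix haper hμ hlt).trans_le (e ▸ hhi m)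

/-! ### Density of the values of the rank function -/

/-- Half-open intervals placed side by side in the order of a key cover the interval. -/
theorem exists_tile {ι κ : Type*} [Fintype ι] [LinearOrder κ] {key : ι → κ}
    (hkey : Function.Injective key) {ℓ lo : ι → ℝ}
    (hlo : ∀ x, lo x = ∑ y ∈ Finset.univ.filter (fun y => key y < key x), ℓ y) {t : ℝ}
    (ht0 : 0 ≤ t) (ht1 : t < ∑ x, ℓ x) : ∃ x, lo x ≤ t ∧ t < lo x + ℓ x := by
  classical
  have hne : (Finset.univ : Finset ι).Nonempty := by
    rw [Finset.nonempty_iff_ne_empty]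
    intro h
    rw [h, Finset.sum_empty] at ht1
    exact ht1.not_ge ht0
  obtain ⟨x₀, -, hx₀⟩ := Finset.exists_min_image Finset.univ key hne
  have hx₀lo : lo x₀ ≤ t := by
    rw [hlo, Finset.filter_false_of_mem fun y hy => (hx₀ y hy).not_gt, Finset.sum_empty]
    exact ht0
  obtain ⟨x, hx, hmax⟩ := Finset.exists_max_image (Finset.univ.filter fun x => lo x ≤ t) key
    ⟨x₀, by simpa using hx₀lo⟩
  simp only [Finset.mem_filter, Finset.mem_univ, true_and] at hx hmax
  refine ⟨x, hx, ?_⟩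
  have hins : lo x + ℓ x = ∑ y ∈ Finset.univ.filter (fun y => key y ≤ key x), ℓ y := by
    have : Finset.univ.filter (fun y => key y ≤ key x) =
        insert x (Finset.univ.filter fun y => key y < key x) := by
      ext y
      simp [le_iff_eq_or_lt, hkey.eq_iff]
    rw [this, Finset.sum_insert (by simp), ← hlo, add_comm]
  rw [hins]
  -- Here x is the last tile starting at or before t. Its upper end is the total length, or else the
  -- lower end of the next tile y.
  rcases (Finset.univ.filter fun y => key x < key y).eq_empty_or_nonempty with he | he
  · rw [Finset.filter_true_of_mem]
    · exact ht1
    · intro y _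
      by_contra! hy
      exact absurd (Finset.mem_filter.mpr ⟨Finset.mem_univ y, hy⟩) (he ▸ Finset.notMem_empty y)
  · obtain ⟨y, hy, hmin⟩ := Finset.exists_min_image _ key he
    simp only [Finset.mem_filter, Finset.mem_univ, true_and] at hy hmin
    have : Finset.univ.filter (fun z => key z ≤ key x) =
        Finset.univ.filter (fun z => key z < key y) := by
      ext z
      simp only [Finset.mem_filter, Finset.mem_univ, true_and]
      refine ⟨fun hz => hz.trans_lt hy, fun hz => ?_⟩
      by_contra! hxz
      exact hz.not_ge (hmin z hxz)
    rw [this, ← hlo]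
    by_contra! hcon
    exact (hmax y hcon).not_gt hy

theorem IsFrequencyVector.exists_letter_tile (hμ : IsFrequencyVector φ u μ θ) {t : ℝ}
    (ht : t ∈ Set.Ico (0 : ℝ) 1) : ∃ b, t ∈ Set.Ico (loI μ b) (hiI μ b) :=
  exists_tile (key := id) (ℓ := μ) Function.injective_id (fun _ => rfl) ht.1
    (hμ.sum_eq_one.symm ▸ ht.2)

theorem IsFrequencyVector.sum_type (hμ : IsFrequencyVector φ u μ θ)
    (h : IsPrimitiveMorphism φ) : ∑ τ : PosType φ, μ τ.1 / θ = 1 := by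
  refine (HasSlope.sum Finset.univ fun τ _ => hμ.slope_hasType h τ).unique ?_
  convert hasSlope_true using 2 with k
  rw [← countBelow_exists (S := fun σ k => HasType φ u k σ) _
    (fun a _ b _ x ha hb => h.hasType_unique ha hb)]
  congr 1
  ext x
  simpa using h.exists_hasType u x

theorem IsRankFunction.exists_type_tile {a : ℕ → ℝ} (ha : IsRankFunction u a)
    (h : IsPrimitiveMorphism φ) (hfix : IsFixedPoint φ u) (haper : Aperiodic u)
    (hsep : Separable φ u) (hμ : IsFrequencyVector φ u μ θ) {t : ℝ}
    (ht : t ∈ Set.Ico (0 : ℝ) 1) :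
    ∃ τ, t ∈ Set.Ico (loJ φ u μ θ τ) (hiJ φ u μ θ τ) := by
  classical
  -- The ranks of sample positions, one for each type, serve as keys for the order of types.
  choose pos hpos using hμ.exists_hasType
  have hinj : Function.Injective fun τ => a (pos τ) := fun τ σ e => by
    have := ha.injective h hfix haper hμ e
    exact h.hasType_unique (hpos τ) (this ▸ hpos σ)
  refine exists_tile (key := fun τ => a (pos τ)) (ℓ := fun τ => μ τ.1 / θ) hinj (fun τ => ?_) ht.1
    ((hμ.sum_type h).symm ▸ ht.2)
  rw [loJ]
  congr 1
  ext σ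
  simp only [Finset.mem_filter, Finset.mem_univ, true_and]
  by_cases e : σ = τ
  · subst e
    exact ⟨fun hlt => absurd rfl hlt.1, fun hlt => absurd hlt (lt_irrefl _)⟩
  · rw [typeLt_iff hsep e (hpos σ) (hpos τ), ha.lt_iff h hfix haper hμ]

theorem IsRankFunction.mem_Icc {a : ℕ → ℝ} (ha : IsRankFunction u a) (i : ℕ) :
    a i ∈ Set.Icc (0 : ℝ) 1 :=
  ⟨hasSlope_false.le_of_imp (ha i) fun _ => False.elim,
    (ha i).le_of_imp hasSlope_true fun _ _ => trivial⟩

theorem IsFrequencyVector.eq_of_mem_Ico (hμ : IsFrequencyVector φ u μ θ) {b c : Fin q} {t : ℝ}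
    (hb : t ∈ Set.Ico (loI μ b) (hiI μ b)) (hc : t ∈ Set.Ico (loI μ c) (hiI μ c)) : b = c := by
  by_contra hne
  rcases lt_or_gt_of_ne hne with hlt | hlt
  · exact ((hb.2.trans_le (hμ.hiI_le_loI hlt)).trans_le hc.1).false
  · exact ((hc.2.trans_le (hμ.hiI_le_loI hlt)).trans_le hb.1).false

/-- The number t is pulled back by the affine map of its tile, approximated there, and pushed
forward, which gains a factor 1 / θ. The condition on the letter u i ensures that the block of i is
the one to which this map belongs. -/
theorem IsRankFunction.exists_near_pow {a : ℕ → ℝ} (ha : IsRankFunction u a)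
    (h : IsPrimitiveMorphism φ) (hmono : IsMonotoneMorphism φ) (hfix : IsFixedPoint φ u)
    (haper : Aperiodic u) (hsep : Separable φ u) (hμ : IsFrequencyVector φ u μ θ) (n : ℕ) :
    ∀ t ∈ Set.Ico (0 : ℝ) 1, ∃ i, t ∈ Set.Ico (loI μ (u i)) (hiI μ (u i)) ∧
      |a i - t| ≤ θ⁻¹ ^ n := by
  have hθ := hμ.theta_pos
  induction n with
  | zero =>
    intro t ht
    obtain ⟨b, hb⟩ := hμ.exists_letter_tile ht
    obtain ⟨i, rfl⟩ := hμ.exists_apply_eq b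
    refine ⟨i, hb, ?_⟩
    have := ha.mem_Icc i
    rw [pow_zero, abs_le]
    constructor <;> linarith [this.1, this.2, ht.1, ht.2]
  | succ n ih =>
    intro t ht
    obtain ⟨⟨b, p⟩, hτ⟩ := ha.exists_type_tile h hfix haper hsep hμ ht
    set lo := loJ φ u μ θ ⟨b, p⟩ with hlo
    have hhi : hiJ φ u μ θ ⟨b, p⟩ = lo + μ b / θ := rfl
    have ht' : (t - lo) * θ + loI μ b ∈ Set.Ico (loI μ b) (hiI μ b) := by
      refine ⟨le_add_of_nonneg_left (mul_nonneg (sub_nonneg.mpr hτ.1) hθ.le), ?_⟩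
      have h2 := hτ.2
      rw [hhi, ← sub_lt_iff_lt_add', lt_div_iff₀ hθ] at h2
      rw [hiI]
      linarith
    obtain ⟨i, hi, hai⟩ := ih _ ⟨(hμ.loI_nonneg b).trans ht'.1, ht'.2.trans_le (hμ.hiI_le_one b)⟩
    obtain rfl := hμ.eq_of_mem_Ico hi ht'
    have hu : u (blockStart φ u i + p) = (φ (u i)).get p := hfix.apply_add i p
    refine ⟨blockStart φ u i + p, ?_, ?_⟩
    · rw [hu]
      exact ⟨(hμ.loI_le_loJ h hfix ⟨u i, p⟩).trans hτ.1,
        hτ.2.trans_le (hμ.hiJ_le_hiI h hfix ⟨u i, p⟩)⟩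
    · rw [ha.apply_block h hmono hfix hsep hμ, psiMap_eq hμ, ← hlo]
      have e : (a i - loI μ (u i)) / θ + lo - t =
          (a i - ((t - lo) * θ + loI μ (u i))) * θ⁻¹ := by
        field_simp
        ring
      rw [e, abs_mul, abs_of_pos (inv_pos.mpr hθ), pow_succ]
      exact mul_le_mul_of_nonneg_right hai (inv_pos.mpr hθ).le

theorem IsRankFunction.exists_near {a : ℕ → ℝ} (ha : IsRankFunction u a)
    (h : IsPrimitiveMorphism φ) (hmono : IsMonotoneMorphism φ) (hfix : IsFixedPoint φ u)
    (haper : Aperiodic u) (hsep : Separable φ u) (hμ : IsFrequencyVector φ u μ θ) {t ε : ℝ}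
    (ht : t ∈ Set.Ico (0 : ℝ) 1) (hε : 0 < ε) : ∃ i, |a i - t| ≤ ε := by
  obtain ⟨n, hn⟩ := exists_pow_lt_of_lt_one hε (inv_lt_one_of_one_lt₀ hμ.one_lt)
  obtain ⟨i, -, hi⟩ := ha.exists_near_pow h hmono hfix haper hsep hμ n t ht
  exact ⟨i, hi.trans hn.le⟩

/-! ### The canonical representative -/

/-- By density some ranks lie within ε / 4 of t ± ε / 4, and the corresponding sets of smaller
shifts enclose {a < t}. Where t ± ε / 4 leaves [0, 1), trivial bounds on counts suffice. -/
theorem IsRankFunction.isCanonical {a : ℕ → ℝ} (ha : IsRankFunction u a)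
    (h : IsPrimitiveMorphism φ) (hmono : IsMonotoneMorphism φ) (hfix : IsFixedPoint φ u)
    (haper : Aperiodic u) (hsep : Separable φ u) (hμ : IsFrequencyVector φ u μ θ) :
    IsCanonical a := by
  refine ⟨ha.injective h hfix haper hμ, ha.mem_Icc, fun t ht => hasUniformFreq_iff.mpr ?_⟩
  intro ε hε
  have hlow : ∃ C, ∀ i j : ℕ, i ≤ j → (t - ε) * ((j : ℝ) - i) - C ≤
      countBelow (fun k => a k < t) j - countBelow (fun k => a k < t) i := by
    rcases lt_or_ge (t - ε / 4) 0 with hneg | hpos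
    · refine ⟨0, fun i j hij => ?_⟩
      have h1 := mul_nonneg (by linarith : 0 ≤ ε - t) (cast_sub_nonneg hij)
      have h2 := countBelow_sub_nonneg (fun k => a k < t) hij
      linarith
    · obtain ⟨k, hk⟩ := ha.exists_near h hmono hfix haper hsep hμ
        (t := t - ε / 4) (ε := ε / 4) ⟨hpos, by linarith [ht.2]⟩ (by linarith)
      rw [abs_le] at hk
      obtain ⟨C, hC⟩ := ha k (ε / 2) (by linarith)
      refine ⟨C, fun i j hij => ?_⟩
      have h1 := (abs_le.mp (hC i j hij)).1
      have h2 := countBelow_mono_sub (S := fun x => LexLt (shift x u) (shift k u))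
        (R := fun x => a x < t) (fun x hx => ?_) hij
      · have h3 := mul_le_mul_of_nonneg_right (by linarith : t - ε / 2 ≤ a k)
          (cast_sub_nonneg hij)
        linarith
      · have := ha.lt_of_lexLt h hfix haper hμ hx
        linarith
  have hup : ∃ C, ∀ i j : ℕ, i ≤ j → countBelow (fun k => a k < t) j -
      countBelow (fun k => a k < t) i ≤ (t + ε) * ((j : ℝ) - i) + C := by
    rcases lt_or_ge (t + ε / 4) 1 with hlt | hge
    · obtain ⟨k, hk⟩ := ha.exists_near h hmono hfix haper hsep hμ
        (t := t + ε / 4) (ε := ε / 4) ⟨by linarith [ht.1], hlt⟩ (by linarith)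
      rw [abs_le] at hk
      obtain ⟨C, hC⟩ := ha k (ε / 2) (by linarith)
      refine ⟨C, fun i j hij => ?_⟩
      have h1 := (abs_le.mp (hC i j hij)).2
      have h2 := countBelow_mono_sub (S := fun x => a x < t)
        (R := fun x => LexLt (shift x u) (shift k u)) (fun x hx => ?_) hij
      · have h3 := mul_le_mul_of_nonneg_right (by linarith : a k ≤ t + ε / 2)
          (cast_sub_nonneg hij)
        linarith
      · rw [← ha.lt_iff h hfix haper hμ]
        linarith
    · refine ⟨0, fun i j hij => ?_⟩
      have h1 := mul_nonneg (by linarith : 0 ≤ t + ε - 1) (cast_sub_nonneg hij)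
      have h2 := countBelow_sub_le (fun k => a k < t) hij
      linarith
  obtain ⟨C, hC⟩ := hlow
  obtain ⟨D, hD⟩ := hup
  refine ⟨max C D, fun i j hij => ?_⟩
  have h1 := hC i j hij
  have h2 := hD i j hij
  have h3 := le_max_left C D
  have h4 := le_max_right C D
  rw [abs_le]
  constructor <;> linarith

/-! ### Values in base q and the lexicographic order. -/

theorem ofDigits_lt_one {s : ℕ → Fin q} {c : Fin q} {n : ℕ} (h : s n < c) :
    Real.ofDigits s < 1 := by
  have hq : 1 < q := by
    have h1 := c.2
    have h2 : (s n : ℕ) < c := h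
    omega
  rw [← Real.ofDigits_const_last_eq_one' hq]
  have hlast : ∀ b : Fin q, ((b : ℕ) : ℝ) ≤ ((q - 1 : ℕ) : ℝ) := fun b =>
    Nat.cast_le.mpr (by have := b.2; omega)
  refine Summable.tsum_lt_tsum (i := n) (fun i => ?_) ?_ Real.summable_ofDigitsTerm
    Real.summable_ofDigitsTerm
  · simp only [Real.ofDigitsTerm]
    exact mul_le_mul_of_nonneg_right (hlast _) (by positivity)
  · simp only [Real.ofDigitsTerm]
    have hq0 : (0 : ℝ) < q := by exact_mod_cast (by omega : 0 < q)
    refine mul_lt_mul_of_pos_right ?_ (by positivity)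
    exact lt_of_lt_of_le (Nat.cast_lt.mpr h) (hlast c)

/-- Only a tail of greatest digits could make the values equal, and `hs` excludes it; for shifts of
u it follows from aperiodicity. -/
theorem ofDigits_lt_of_lexLt {s t : ℕ → Fin q} (h : LexLt s t)
    (hs : ∀ N, ∃ n ≥ N, ∃ c, s n < c) : Real.ofDigits s < Real.ofDigits t := by
  obtain ⟨d, hd, hlt⟩ := h
  have hq0 : (0 : ℝ) < q := by exact_mod_cast Fin.pos (s 0)
  rw [Real.ofDigits_eq_sum_add_ofDigits s (d + 1), Real.ofDigits_eq_sum_add_ofDigits t (d + 1),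
    Finset.sum_range_succ, Finset.sum_range_succ]
  have e : ∑ i ∈ Finset.range d, Real.ofDigitsTerm s i =
      ∑ i ∈ Finset.range d, Real.ofDigitsTerm t i :=
    Finset.sum_congr rfl fun i hi => by simp [Real.ofDigitsTerm, hd i (Finset.mem_range.mp hi)]
  obtain ⟨n, hn, c, hc⟩ := hs (d + 1)
  have h1 : Real.ofDigits (fun i => s (i + (d + 1))) < 1 :=
    ofDigits_lt_one (n := n - (d + 1)) (c := c) (by rwa [Nat.sub_add_cancel hn])
  have h2 := Real.ofDigits_nonneg fun i => t (i + (d + 1))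
  have hP : (0 : ℝ) < ((q : ℝ) ^ (d + 1))⁻¹ := by positivity
  have h3 : ((s d : ℕ) : ℝ) + 1 ≤ (t d : ℕ) := by exact_mod_cast hlt
  rw [e, Real.ofDigitsTerm, Real.ofDigitsTerm]
  have h4 := mul_le_mul_of_nonneg_right h3 hP.le
  have h5 := mul_lt_mul_of_pos_left h1 hP
  have h6 := mul_nonneg hP.le h2
  linarith

theorem Aperiodic.exists_lt (haper : Aperiodic u) (N : ℕ) : ∃ n ≥ N, ∃ c, u n < c := by
  by_contra! hcon
  refine haper ⟨1, one_pos, N, fun n hn => ?_⟩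
  exact le_antisymm (hcon n hn _) (hcon (n + 1) (by omega) _)

theorem ofDigits_shift_lt_iff (haper : Aperiodic u) (i j : ℕ) :
    Real.ofDigits (shift i u) < Real.ofDigits (shift j u) ↔ LexLt (shift i u) (shift j u) := by
  have key : ∀ i j, LexLt (shift i u) (shift j u) →
      Real.ofDigits (shift i u) < Real.ofDigits (shift j u) := by
    intro i j hij
    refine ofDigits_lt_of_lexLt hij fun N => ?_
    obtain ⟨n, hn, c, hc⟩ := haper.exists_lt (i + N)
    exact ⟨n - i, by omega, c, by rwa [shift, Nat.add_sub_cancel' (by omega)]⟩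
  refine ⟨fun hlt => ?_, key i j⟩
  rcases eq_or_ne i j with rfl | hne
  · exact absurd hlt (lt_irrefl _)
  · exact (haper.lexLt_or_lexLt hne).resolve_right fun hji => hlt.asymm (key j i hji)

theorem IsRankFunction.isCanonicalRepresentative_iff {a : ℕ → ℝ} (ha : IsRankFunction u a)
    (h : IsPrimitiveMorphism φ) (hmono : IsMonotoneMorphism φ) (hfix : IsFixedPoint φ u)
    (haper : Aperiodic u) (hsep : Separable φ u) (hμ : IsFrequencyVector φ u μ θ) (s : ℕ → ℝ) :
    IsCanonicalRepresentative (wordPermutation u) s ↔ s = a := by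
  constructor
  · rintro ⟨⟨-, hs⟩, -, hs01, hsf⟩
    ext i
    -- The threshold t = s i turns canonicity into a statement about the frequency of shifts smaller
    -- than T^i u.
    refine (hasUniformFreq_iff.mp (hsf (s i) (hs01 i))).unique ?_
    convert ha i using 2
    ext x
    rw [hs x i, ofDigits_shift_lt_iff haper]
  · rintro rfl
    refine ⟨⟨ha.injective h hfix haper hμ, fun i j => ?_⟩,
      ha.isCanonical h hmono hfix haper hsep hμ⟩
    rw [ha.lt_iff h hfix haper hμ, ofDigits_shift_lt_iff haper]

/-! ### The morphism `ψ` -/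

theorem psi_eq_of_mem (hμ : IsFrequencyVector φ u μ θ) {b : Fin q} {x : ℝ}
    (hx : x ∈ intervalI u μ b) :
    psi φ u μ θ x = List.ofFn fun p : Fin (φ b).length => psiMap φ u μ θ ⟨b, p⟩ x := by
  have hex : ∃ a, x ∈ intervalI u μ a := ⟨b, hx⟩
  have e : hex.choose = b := hμ.eq_of_mem_intervalI hex.choose_spec hx
  rw [psi, dif_pos hex, e]

/-- The list ψ(a n) is as long as φ (u n), so both morphisms cut into the same blocks, and the value
at k > 0 is determined by the value at the smaller index of its block. -/
theorem IsRankFunction.isFixedPoint_psi_iff {a : ℕ → ℝ} (ha : IsRankFunction u a)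
    (h : IsPrimitiveMorphism φ) (hmono : IsMonotoneMorphism φ) (hfix : IsFixedPoint φ u)
    (haper : Aperiodic u) (hsep : Separable φ u) (hμ : IsFrequencyVector φ u μ θ) (s : ℕ → ℝ) :
    s 0 = a 0 ∧ IsFixedPoint (psi φ u μ θ) s ↔ s = a := by
  have hpsi : ∀ n, psi φ u μ θ (a n) =
      List.ofFn fun p : Fin (φ (u n)).length => psiMap φ u μ θ ⟨u n, p⟩ (a n) := fun n =>
    psi_eq_of_mem hμ (ha.mem_intervalI h hfix haper hμ n)
  have hlen : ∀ n, (psi φ u μ θ (a n)).length = (φ (u n)).length := fun n => by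
    rw [hpsi, List.length_ofFn]
  have hget : ∀ n (p : Fin (psi φ u μ θ (a n)).length),
      a (blockStart φ u n + p) = (psi φ u μ θ (a n)).get p := by
    intro n p
    have h1 := ha.apply_block h hmono hfix hsep hμ n ⟨p, (hlen n) ▸ p.2⟩
    rw [h1]
    simp only [List.get_eq_getElem, hpsi, List.getElem_ofFn]
  have hbs : ∀ (s : ℕ → ℝ) (n : ℕ), (∀ i < n, s i = a i) →
      blockStart (psi φ u μ θ) s n = blockStart φ u n := by
    intro s n hs
    refine Finset.sum_congr rfl fun i hi => ?_
    rw [hs i (Finset.mem_range.mp hi), hlen]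
  constructor
  · rintro ⟨h0, -, hs⟩
    ext k
    induction k using Nat.strong_induction_on with
    | _ k ih =>
      rcases Nat.eq_zero_or_pos k with rfl | hk
      · exact h0
      obtain ⟨m, p, rfl⟩ := h.exists_position u k
      have hmk : m < blockStart φ u m + p := by
        rcases Nat.eq_zero_or_pos m with rfl | hm
        · exact hk
        · exact (lt_blockStart h hfix haper hm).trans_le (Nat.le_add_right _ _)
      have hsm := ih m hmk
      have h1 := hs m
      rw [hbs s m fun i hi => ih i (hi.trans hmk), hsm] at h1
      have h2 := h1 ⟨p, (hlen m).symm ▸ p.2⟩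
      rw [← hget] at h2
      exact h2
  · rintro rfl
    have e : blockStart (psi φ u μ θ) s = blockStart φ u :=
      funext fun n => hbs s n fun _ _ => rfl
    refine ⟨rfl, ?_, fun n p => ?_⟩
    · rw [e]
      exact (h.blockStart_strictMono u).tendsto_atTop
    · rw [e]
      exact hget n p

theorem IsFrequencyVector.eq_of_psiMap_eq (hμ : IsFrequencyVector φ u μ θ) {τ : PosType φ}
    {x y : ℝ} (hx : psiMap φ u μ θ τ x = x) (hy : psiMap φ u μ θ τ y = y) : x = y := by
  rw [psiMap_eq hμ] at hx hy
  have hθ := hμ.theta_pos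
  have e : (x - y) / θ = x - y := by
    linear_combination hx - hy
  rw [div_eq_iff hθ.ne'] at e
  have : (x - y) * (θ - 1) = 0 := by linear_combination -e
  rcases mul_eq_zero.mp this with h1 | h1
  · exact sub_eq_zero.mp h1
  · exact absurd (sub_eq_zero.mp h1) hμ.one_lt.ne'

end MorphicPerm

end

open MorphicPerm in
theorem mainTheorem2 (q : ℕ) (φ : Fin q → List (Fin q)) (u : ℕ → Fin q)
    (hprim : IsPrimitiveMorphism φ) (hmono : IsMonotoneMorphism φ)
    (hfix : IsFixedPoint φ u) (haper : Aperiodic u) (hsep : Separable φ u) :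
    ∃ (μ : Fin q → ℝ) (θ : ℝ),
      (∀ b, HasUniformFreq (fun n => u n = b) (μ b)) ∧
      IsPerronFrobenius φ θ ∧
      (∀ τ : PosType φ, intervalJ φ u μ θ τ ⊆ intervalI u μ ((φ τ.1).get τ.2)) ∧
      ∃ (h0 : 0 < (φ (u 0)).length) (x : ℝ),
        (∀ y : ℝ, y ∈ intervalI u μ (u 0) ∧ psiMap φ u μ θ ⟨u 0, ⟨0, h0⟩⟩ y = y ↔ y = x) ∧
        ∃ a : ℕ → ℝ,
          (∀ s : ℕ → ℝ, s 0 = x ∧ IsFixedPoint (psi φ u μ θ) s ↔ s = a) ∧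
          (∀ s : ℕ → ℝ, IsCanonicalRepresentative (wordPermutation u) s ↔ s = a) := by
  obtain ⟨μ, θ, hμ⟩ := exists_isFrequencyVector hprim hfix haper
  obtain ⟨a, ha⟩ := exists_isRankFunction hprim hmono hfix hsep hμ
  refine ⟨μ, θ, fun b => hasUniformFreq_iff.mpr (hμ.slope b), hμ.isPerronFrobenius hprim,
    fun τ => halfOpen_subset u (hμ.loI_le_loJ hprim hfix τ) (hμ.hiJ_le_hiI hprim hfix τ),
    hprim.length_pos _, a 0, fun y => ?_, a,
    ha.isFixedPoint_psi_iff hprim hmono hfix haper hsep hμ,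
    ha.isCanonicalRepresentative_iff hprim hmono hfix haper hsep hμ⟩
  -- Position 0 is the first place of block 0, so the recursion at 0 is the fixed-point equation.
  have h0 : psiMap φ u μ θ ⟨u 0, ⟨0, hprim.length_pos _⟩⟩ (a 0) = a 0 := by
    rw [← ha.apply_block hprim hmono hfix hsep hμ]
    simp [blockStart_zero]
  constructor
  · rintro ⟨-, hy⟩
    exact hμ.eq_of_psiMap_eq hy h0
  · rintro rfl
    exact ⟨ha.mem_intervalI hprim hfix haper hμ 0, h0⟩
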